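/- **Setting.** Let $\mathrm K=\mathrm{diag}(1,1,-1)$ and $\langle u,v\rangle_{\mathrm K}=(u,\mathrm K v)$ on $\mathbb R^3$, where $(\cdot,\cdot)$ is the Euclidean scalar product. The Lobachevsky plane is $L^2=\{(X,Y,Z)\in\mathbb R^3: X^2+Y^2-Z^2=-1,\ Z>0\}$ with the Riemannian metric induced by $\langle\cdot,\cdot\rangle_{\mathrm K}$. Let $SO(2,1)$ denote the group of its orientation preserving isometries, i.e. the real $3\times3$ matrices $g$ with $g^T\mathrm K g=\mathrm K$ and $\det g=1$ that map $L^2$ to itself. Let $so(2,1)=\{\xi:\xi^T\mathrm K+\mathrm K\xi=0\}$ be its Lie algebra, with the commutator, identified with $\mathbb R^3$ by $\omega\mapsto\widehat\omega\,\mathrm K$, where $\widehat\omega v=\omega\times v$. Let $Q=(L^2\times L^2)\setminus\Delta$, where $\Delta$ is the diagonal (the collision set), let $T^*Q$ carry its canonical Poisson bracket (positions $x_i$ and conjugate momenta $\xi_j$ satisfy $\{x_i,\xi_j\}=\delta_{ij}$), and let $SO(2,1)$ act on $T^*Q$ by the cotangent lift of the diagonal action on $Q$. For masses $\mu_1,\mu_2>0$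 and a potential $U:(0,\infty)\to\mathbb R$, let $H=T+U$ on $T^*Q$, where $T$ is the kinetic energy (the Legendre transform of $\frac12\sum_\alpha\mu_\alpha\langle v_\alpha,v_\alpha\rangle_{\mathrm K}$) and $U$ is evaluated at the Riemannian distance of the two bodies. **Theorem.** 1. The relations $$\{m_x,m_y\}=m_z,\quad \{m_y,m_z\}=-m_x,\quad \{m_z,m_x\}=-m_y,\quad \{q,p\}=1,$$ with all the other brackets of coordinate functions equal to zero, define a Poisson bracket on the smooth functions on $\mathbb R^3\times(0,\infty)\times\mathbb R\ni(\boldsymbol m,q,p)$, $\boldsymbol m=(m_x,m_y,m_z)^T$. It is the product of the Lie–Poisson bracket $\{f,g\}(\boldsymbol m)=-(\boldsymbol m,[\nabla f,\nabla g]_{so(2,1)})$ on $so(2,1)^*\cong\mathbb R^3$ and the canonical bracket of $(q,p)$. 2. The reduced space $T^*Q/SO(2,1)$ is isomorphic, as a Poisson manifold, to $\mathbb R^3\times(0,\infty)\times\mathbb R$ with this bracket: there is a homeomorphism $\Phi:T^*Q/SO(2,1)\to\mathbb R^3\times(0,\infty)\times\mathbb R$ whose composition $J$ with the projection $T^*Q\to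 T^*Q/SO(2,1)$ is a smooth submersion, such that a function $f$ on $\mathbb R^3\times(0,\infty)\times\mathbb R$ is smooth if and only if $f\circ J$ is smooth, and $\{f\circ J,g\circ J\}=\{f,g\}\circ J$ for all smooth $f,g$. Moreover $\Phi$ can be chosen independently of the masses and the potential, with $q\circ J$ equal to the Riemannian distance of the bodies, and such that the following holds. 3. For all $\mu_1,\mu_2>0$ and all differentiable $U:(0,\infty)\to\mathbb R$, the reduced dynamics is Hamiltonian with respect to this bracket, with the Hamiltonian $$H(\boldsymbol m,q,p)=\frac1{2\mu_1}\left((\boldsymbol m,\mathbf A(q)\boldsymbol m)-2m_xp+(1+\mu)p^2\right)+U(q),$$ $$\mathbf A(q)=\begin{pmatrix}1&0&0\\0&1&-\dfrac{\cosh q}{\sinh q}\\0&-\dfrac{\cosh q}{\sinh q}&\dfrac{\mu+\cosh^2q}{\sinh^2q}\end{pmatrix},\qquad \mu=\frac{\mu_1}{\mu_2}.$$ That is, the Hamiltonian $T+U$ on $T^*Q$ equals $H\circ J$, and $J$ maps solutions of Hamilton's equations of $T+U$ on $T^*Q$ to solutions of $\dot m_a=\{m_a,H\}$ $(a=x,y,z)$,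 $\dot q=\{q,H\}$, $\dot p=\{p,H\}$. 4. The function $C(\boldsymbol m)=-\langle\boldsymbol m,\boldsymbol m\rangle_{\mathrm K}=-m_x^2-m_y^2+m_z^2$ is a Casimir function of this bracket: $\{C,f\}=0$ for every smooth $f$. It is the only one up to functional dependence: the differential of every Casimir function $F$ is a multiple of $dC$ at every point with $\boldsymbol m\ne0$. -/

import Mathlib

open Set Topology Matrix Manifold ContDiff

noncomputable section

namespace TwoBodyL2

/-! ### Minkowski space and the Lobachevsky plane -/

/-- The matrix `K = diag(1, 1, -1)`. -/
def K : Matrix (Fin 3) (Fin 3) ℝ := Matrix.diagonal ![1, 1, -1]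

/-- The Minkowski scalar product `⟨u, v⟩_K = (u, K v)` on `ℝ³`. -/
def mink (u v : Fin 3 → ℝ) : ℝ := u ⬝ᵥ (K *ᵥ v)

theorem mink_eq (u v : Fin 3 → ℝ) : mink u v = u 0 * v 0 + u 1 * v 1 - u 2 * v 2 := by
  simp [mink, K, Matrix.mulVec_diagonal, dotProduct, Fin.sum_univ_three]
  ring

theorem mink_mulVec (g : Matrix (Fin 3) (Fin 3) ℝ) (u v : Fin 3 → ℝ) :
    mink (g *ᵥ u) (g *ᵥ v) = u ⬝ᵥ ((gᵀ * K * g) *ᵥ v) := by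
  rw [mink, ← Matrix.vecMul_transpose, ← Matrix.dotProduct_mulVec]
  simp only [Matrix.mulVec_mulVec, Matrix.mul_assoc]

/-- The Lobachevsky plane: the upper sheet of the hyperboloid `X² + Y² - Z² = -1` in `ℝ³`. -/
def L2 : Set (Fin 3 → ℝ) := {R | mink R R = -1 ∧ 0 < R 2}

/-- The tangent space of the Lobachevsky plane at `R`. The restriction of `mink` to it is the
Riemannian metric. -/
def tangentL2 (R : L2) : Submodule ℝ (Fin 3 → ℝ) where
  carrier := {v | mink R v = 0}
  add_mem' := by
    intro a b ha hb
    change mink R a = 0 at ha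
    change mink R b = 0 at hb
    change mink R (a + b) = 0
    simp only [mink_eq, Pi.add_apply] at *
    linarith
  zero_mem' := by simp [mink_eq]
  smul_mem' := by
    intro c a ha
    change mink R a = 0 at ha
    change mink R (c • a) = 0
    simp only [mink_eq, Pi.smul_apply, smul_eq_mul] at *
    linear_combination c * ha

theorem mem_tangentL2 {R : L2} {v : Fin 3 → ℝ} : v ∈ tangentL2 R ↔ mink R v = 0 := Iff.rfl

/-- The Riemannian length of a curve `[0, 1] → L2`. -/
def curveLength (c : ℝ → Fin 3 → ℝ) : ℝ :=
  ∫ t in (0 : ℝ)..1, Real.sqrt (mink (deriv c t) (deriv c t))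

/-- The Riemannian distance of the Lobachevsky plane: the infimum of the lengths of the `C¹`
curves in `L2` that join the two points. -/
def riemDist (R S : L2) : ℝ :=
  sInf {l : ℝ | ∃ c : ℝ → Fin 3 → ℝ, ContDiff ℝ 1 c ∧ (∀ t ∈ Icc (0 : ℝ) 1, c t ∈ L2) ∧
    c 0 = R ∧ c 1 = S ∧ l = curveLength c}

/-! ### The symmetry group -/

/-- The group `SO(2,1)` of orientation preserving isometries of the Lobachevsky plane: the matrices
`g` with `det g = 1` and `gᵀ K g = K` that map the upper sheet of the hyperboloid to itself. -/
def SO21 : Subgroup (Matrix.SpecialLinearGroup (Fin 3) ℝ) where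
  carrier := {g | (g : Matrix (Fin 3) (Fin 3) ℝ)ᵀ * K * (g : Matrix (Fin 3) (Fin 3) ℝ) = K ∧
    ∀ R ∈ L2, (g : Matrix (Fin 3) (Fin 3) ℝ) *ᵥ R ∈ L2}
  one_mem' := by simp
  mul_mem' := by
    rintro a b ⟨ha, ha'⟩ ⟨hb, hb'⟩
    refine ⟨?_, fun R hR => ?_⟩
    · rw [Matrix.SpecialLinearGroup.coe_mul, Matrix.transpose_mul]
      calc _ = (b : Matrix (Fin 3) (Fin 3) ℝ)ᵀ *
            ((a : Matrix (Fin 3) (Fin 3) ℝ)ᵀ * K * (a : Matrix (Fin 3) (Fin 3) ℝ)) *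
            (b : Matrix (Fin 3) (Fin 3) ℝ) := by simp only [Matrix.mul_assoc]
        _ = K := by rw [ha, hb]
    · rw [Matrix.SpecialLinearGroup.coe_mul, ← Matrix.mulVec_mulVec]
      exact ha' _ (hb' _ hR)
  inv_mem' := by
    rintro a ⟨ha, ha'⟩
    have h1 : (a : Matrix (Fin 3) (Fin 3) ℝ) * ((a⁻¹ : Matrix.SpecialLinearGroup (Fin 3) ℝ) :
        Matrix (Fin 3) (Fin 3) ℝ) = 1 := by
      rw [← Matrix.SpecialLinearGroup.coe_mul, mul_inv_cancel, Matrix.SpecialLinearGroup.coe_one]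
    have h2 : (((a⁻¹ : Matrix.SpecialLinearGroup (Fin 3) ℝ) : Matrix (Fin 3) (Fin 3) ℝ))ᵀ * K *
        ((a⁻¹ : Matrix.SpecialLinearGroup (Fin 3) ℝ) : Matrix (Fin 3) (Fin 3) ℝ) = K := by
      set b := ((a⁻¹ : Matrix.SpecialLinearGroup (Fin 3) ℝ) : Matrix (Fin 3) (Fin 3) ℝ)
      calc bᵀ * K * b = bᵀ * ((a : Matrix (Fin 3) (Fin 3) ℝ)ᵀ * K *
            (a : Matrix (Fin 3) (Fin 3) ℝ)) * b := by rw [ha]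
        _ = ((a : Matrix (Fin 3) (Fin 3) ℝ) * b)ᵀ * K *
            ((a : Matrix (Fin 3) (Fin 3) ℝ) * b) := by
          simp only [Matrix.transpose_mul, Matrix.mul_assoc]
        _ = K := by rw [h1]; simp
    refine ⟨h2, fun R hR => ?_⟩
    set b := ((a⁻¹ : Matrix.SpecialLinearGroup (Fin 3) ℝ) : Matrix (Fin 3) (Fin 3) ℝ)
    have hq : mink (b *ᵥ R) (b *ᵥ R) = -1 := by
      have : mink (b *ᵥ R) (b *ᵥ R) = R ⬝ᵥ ((bᵀ * K * b) *ᵥ R) := by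
        exact mink_mulVec b R R
      rw [this, h2]
      exact hR.1
    refine ⟨hq, ?_⟩
    by_contra hneg
    have h0 : (b *ᵥ R) 2 ≠ 0 := by
      intro h
      rw [mink_eq, h] at hq
      nlinarith [mul_self_nonneg ((b *ᵥ R) 0), mul_self_nonneg ((b *ᵥ R) 1)]
    have hlt : (b *ᵥ R) 2 < 0 := lt_of_le_of_ne (not_lt.1 hneg) h0
    have hm : -(b *ᵥ R) ∈ L2 := by
      refine ⟨?_, by simpa using hlt⟩
      rw [mink_eq] at hq ⊢
      simpa using hq
    have h3 := (ha' _ hm).2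
    rw [Matrix.mulVec_neg, Matrix.mulVec_mulVec, h1, Matrix.one_mulVec] at h3
    have h4 := hR.2
    simp only [Pi.neg_apply] at h3
    linarith

/-- The action of a matrix of `SO21` on vectors. -/
def act (g : SO21) (v : Fin 3 → ℝ) : Fin 3 → ℝ :=
  ((g : Matrix.SpecialLinearGroup (Fin 3) ℝ) : Matrix (Fin 3) (Fin 3) ℝ) *ᵥ v

theorem act_one (v : Fin 3 → ℝ) : act 1 v = v := by simp [act]

theorem act_mul (g h : SO21) (v : Fin 3 → ℝ) : act (g * h) v = act g (act h v) := by
  simp [act, Matrix.mulVec_mulVec]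

theorem act_mem (g : SO21) {R : Fin 3 → ℝ} (hR : R ∈ L2) : act g R ∈ L2 := g.2.2 R hR

theorem act_inv_act (g : SO21) (v : Fin 3 → ℝ) : act g⁻¹ (act g v) = v := by
  rw [← act_mul, inv_mul_cancel, act_one]

theorem act_act_inv (g : SO21) (v : Fin 3 → ℝ) : act g (act g⁻¹ v) = v := by
  rw [← act_mul, mul_inv_cancel, act_one]

theorem mink_act (g : SO21) (u v : Fin 3 → ℝ) : mink (act g u) (act g v) = mink u v := by
  rw [act, act, mink_mulVec, g.2.1, mink]

/-- The isometry of `L2` given by `g`. -/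
def actL2 (g : SO21) (R : L2) : L2 := ⟨act g R, act_mem g R.2⟩

/-- The inverse of the derivative at `R` of the isometry given by `g`, as a linear map
`T_{gR} L2 → T_R L2`. -/
def tangentInv (g : SO21) (R : L2) : tangentL2 (actL2 g R) →ₗ[ℝ] tangentL2 R where
  toFun v := ⟨act g⁻¹ v, by
    have h : mink (act g R) v = 0 := v.2
    rw [mem_tangentL2, ← mink_act g, act_act_inv]
    exact h⟩
  map_add' u v := by
    ext1
    simp [act, Matrix.mulVec_add]
  map_smul' c v := by
    ext1
    simp [act, Matrix.mulVec_smul]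

/-! ### The phase space `T*Q` -/

/-- The momentum phase space `T*Q` for `Q = (L2 × L2) \ Δ`, where `Δ` is the collision set (the
diagonal). A point consists of the positions `R 0 ≠ R 1` of the two bodies and of a linear form
on the tangent space `T_{R 0} L2 × T_{R 1} L2` of `Q`, that is, of a linear form on each factor. -/
structure PhaseSpace where
  /-- the positions of the two bodies -/
  R : Fin 2 → L2
  /-- the bodies do not collide -/
  ne : R 0 ≠ R 1
  /-- the momentum covectors of the two bodies -/
  α : ∀ a, Module.Dual ℝ (tangentL2 (R a))

theorem PhaseSpace.ext_covec {z w : PhaseSpace} (hR : ∀ a, (z.R a : Fin 3 → ℝ) = w.R a)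
    (hα : ∀ a v (hv : v ∈ tangentL2 (z.R a)) (hw : v ∈ tangentL2 (w.R a)),
      z.α a ⟨v, hv⟩ = w.α a ⟨v, hw⟩) : z = w := by
  obtain ⟨R, h, α⟩ := z
  obtain ⟨S, h', β⟩ := w
  obtain rfl : R = S := funext fun a => Subtype.ext (hR a)
  congr 1
  funext a
  ext ⟨v, hv⟩
  exact hα a v hv hv

/-- The cotangent lift of the diagonal action of `SO21` on `Q`:
`g • (R, α) = (g R, α ∘ (D g)⁻¹)`. -/
instance : SMul SO21 PhaseSpace where
  smul g z :=
    { R := fun a => actL2 g (z.R a)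
      ne := fun h => z.ne (Subtype.ext (by
        have h1 : act g (z.R 0) = act g (z.R 1) := congrArg Subtype.val h
        rw [← act_inv_act g (z.R 0), h1, act_inv_act]))
      α := fun a => z.α a ∘ₗ tangentInv g (z.R a) }

theorem smul_R (g : SO21) (z : PhaseSpace) (a : Fin 2) :
    ((g • z).R a : Fin 3 → ℝ) = act g (z.R a) := rfl

theorem smul_α (g : SO21) (z : PhaseSpace) (a : Fin 2) (v : Fin 3 → ℝ)
    (hv : v ∈ tangentL2 ((g • z).R a)) (hv' : act g⁻¹ v ∈ tangentL2 (z.R a)) :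
    (g • z).α a ⟨v, hv⟩ = z.α a ⟨act g⁻¹ v, hv'⟩ := rfl

instance : MulAction SO21 PhaseSpace where
  one_smul z := by
    refine PhaseSpace.ext_covec (fun a => by rw [smul_R, act_one]) fun a v hv hw => ?_
    have h : act 1⁻¹ v = v := by rw [inv_one, act_one]
    rw [smul_α 1 z a v hv (by rw [h]; exact hw)]
    congr 2
  mul_smul g h z := by
    refine PhaseSpace.ext_covec (fun a => by rw [smul_R, smul_R, smul_R, act_mul])
      fun a v hv hw => ?_
    have e : act (g * h)⁻¹ v = act h⁻¹ (act g⁻¹ v) := by rw [_root_.mul_inv_rev, act_mul]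
    have h1 : act g⁻¹ v ∈ tangentL2 ((h • z).R a) := by
      rw [mem_tangentL2, ← mink_act g, act_act_inv]
      exact hw
    have h2 : act h⁻¹ (act g⁻¹ v) ∈ tangentL2 (z.R a) := by
      rw [mem_tangentL2, ← mink_act h, act_act_inv]
      exact h1
    rw [smul_α (g * h) z a v hv (by rw [e]; exact h2), smul_α g (h • z) a v hw h1,
      smul_α h z a _ h1 h2]
    congr 2

/-! ### Canonical coordinates, smooth structure and canonical Poisson bracket of `T*Q`

The projection `(X, Y, Z) ↦ (X, Y)` is a global chart of `L2` (a graph over `ℝ²`), so that the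
coordinates `(X, Y)` of the two bodies form a global chart of `Q` and induce global canonical
coordinates `(x, ξ)` on `T*Q`. The first index of a coordinate is the body, the second one chooses
between `X` and `Y`. -/

/-- The model space of `T*Q`: positions and momenta. -/
abbrev Model : Type := (Fin 2 × Fin 2 → ℝ) × (Fin 2 × Fin 2 → ℝ)

/-- The coordinate vector field `∂/∂X` (for `j = 0`) or `∂/∂Y` (for `j = 1`) of the chart `(X, Y)`
of `L2`; as a vector of `ℝ³`, it is `(1, 0, X / Z)` or `(0, 1, Y / Z)`. -/
def coordVec (R : L2) (j : Fin 2) : tangentL2 R :=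
  ⟨![![1, 0] j, ![0, 1] j, (R : Fin 3 → ℝ) j.castSucc / (R : Fin 3 → ℝ) 2], by
    have h : (R : Fin 3 → ℝ) 2 ≠ 0 := R.2.2.ne'
    rw [mem_tangentL2, mink_eq]
    fin_cases j <;> simp <;> field_simp <;> ring⟩

/-- The canonical coordinates: the coordinates `(X, Y)` of the bodies, and the values of the
covectors on the coordinate vector fields `∂/∂X`, `∂/∂Y`. -/
def coords (z : PhaseSpace) : Model :=
  (fun i => (z.R i.1 : Fin 3 → ℝ) i.2.castSucc, fun i => z.α i.1 (coordVec (z.R i.1) i.2))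

/-- The point of `L2` above `(X, Y)`. -/
def lift (x : Fin 2 → ℝ) : L2 :=
  ⟨![x 0, x 1, Real.sqrt (1 + x 0 ^ 2 + x 1 ^ 2)], by
    constructor
    · rw [mink_eq]
      have := Real.mul_self_sqrt (show 0 ≤ 1 + x 0 ^ 2 + x 1 ^ 2 by positivity)
      simp
      linarith
    · simp
      positivity⟩

theorem L2_ext {R S : L2} (h0 : (R : Fin 3 → ℝ) 0 = (S : Fin 3 → ℝ) 0)
    (h1 : (R : Fin 3 → ℝ) 1 = (S : Fin 3 → ℝ) 1) : R = S := by
  have hR := R.2.1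
  have hS := S.2.1
  have pR := R.2.2
  have pS := S.2.2
  rw [mink_eq] at hR hS
  rw [h0, h1] at hR
  have h2 : (R : Fin 3 → ℝ) 2 = (S : Fin 3 → ℝ) 2 := by nlinarith
  ext i
  fin_cases i <;> assumption

theorem tangent_eq (R : L2) (v : tangentL2 R) :
    v = (v : Fin 3 → ℝ) 0 • coordVec R 0 + (v : Fin 3 → ℝ) 1 • coordVec R 1 := by
  have h : (R : Fin 3 → ℝ) 2 ≠ 0 := R.2.2.ne'
  have hv : mink R v = 0 := v.2
  rw [mink_eq] at hv
  ext i
  fin_cases i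
  · simp [coordVec]
  · simp [coordVec]
  · simp [coordVec]
    field_simp
    linarith

theorem coords_injective : Function.Injective coords := by
  intro z w h
  obtain ⟨R, hR, α⟩ := z
  obtain ⟨S, hS, β⟩ := w
  have hx := congrArg Prod.fst h
  have hξ := congrArg Prod.snd h
  obtain rfl : R = S := funext fun a => L2_ext (congrFun hx (a, 0)) (congrFun hx (a, 1))
  congr 1
  funext a
  ext1 v
  have h0 : α a (coordVec (R a) 0) = β a (coordVec (R a) 0) := congrFun hξ (a, 0)
  have h1 : α a (coordVec (R a) 1) = β a (coordVec (R a) 1) := congrFun hξ (a, 1)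
  rw [tangent_eq (R a) v]
  simp only [map_add, map_smul, h0, h1]

theorem range_coords :
    range coords = {y : Model | (fun j => y.1 (0, j)) ≠ (fun j => y.1 (1, j))} := by
  ext ⟨x, ξ⟩
  constructor
  · rintro ⟨z, hz⟩ h
    have hx := congrArg Prod.fst hz
    refine z.ne (L2_ext ?_ ?_)
    · exact (congrFun hx (0, 0)).trans ((congrFun h 0).trans (congrFun hx (1, 0)).symm)
    · exact (congrFun hx (0, 1)).trans ((congrFun h 1).trans (congrFun hx (1, 1)).symm)
  · intro h
    refine ⟨⟨fun a => lift fun j => x (a, j), fun h' => h ?_, fun a =>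
      (ξ (a, 0) • LinearMap.proj 0 + ξ (a, 1) • LinearMap.proj 1) ∘ₗ (tangentL2 _).subtype⟩, ?_⟩
    · have h1 := congrArg Subtype.val h'
      funext j
      fin_cases j
      · exact congrFun h1 0
      · exact congrFun h1 1
    · refine Prod.ext (funext fun i => ?_) (funext fun i => ?_)
      · obtain ⟨a, j⟩ := i
        fin_cases j <;> simp [coords, lift]
      · obtain ⟨a, j⟩ := i
        fin_cases j <;> simp [coords, coordVec]

instance : Nonempty PhaseSpace := by
  have h : ((fun i => if i.1 = 0 then 0 else 1, 0) : Model) ∈ range coords := by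
    rw [range_coords]
    intro h
    have := congrFun h 0
    simp at this
  exact ⟨h.choose⟩

instance : TopologicalSpace PhaseSpace := TopologicalSpace.induced coords inferInstance

theorem isOpenEmbedding_coords : IsOpenEmbedding coords where
  eq_induced := rfl
  injective := coords_injective
  isOpen_range := by
    rw [range_coords]
    exact isOpen_ne_fun (by fun_prop) (by fun_prop)

/-- `T*Q` is a smooth manifold of dimension 8 with the global chart `coords`. -/
instance : ChartedSpace Model PhaseSpace := isOpenEmbedding_coords.singletonChartedSpace

instance : IsManifold 𝓘(ℝ, Model) ∞ PhaseSpace := isOpenEmbedding_coords.isManifold_singleton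

/-- The derivative of a function on `T*Q` in the canonical coordinates. -/
def coordDeriv (f : PhaseSpace → ℝ) (z : PhaseSpace) : Model →L[ℝ] ℝ :=
  fderiv ℝ (f ∘ (isOpenEmbedding_coords.toOpenPartialHomeomorph coords).symm) (coords z)

/-- The partial derivative `∂f/∂x_i`. -/
def dpos (i : Fin 2 × Fin 2) (f : PhaseSpace → ℝ) (z : PhaseSpace) : ℝ :=
  coordDeriv f z (Pi.single i 1, 0)

/-- The partial derivative `∂f/∂ξ_i`. -/
def dmom (i : Fin 2 × Fin 2) (f : PhaseSpace → ℝ) (z : PhaseSpace) : ℝ :=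
  coordDeriv f z (0, Pi.single i 1)

/-- The canonical Poisson bracket on `T*Q`, with `{x_i, ξ_j} = δ_ij`. -/
def canonicalBracket (f g : PhaseSpace → ℝ) (z : PhaseSpace) : ℝ :=
  ∑ i, (dpos i f z * dmom i g z - dmom i f z * dpos i g z)

/-- The curve `c` in `T*Q` satisfies at time `t` Hamilton's canonical equations `ẋ = ∂H/∂ξ`,
`ξ̇ = -∂H/∂x`. -/
def HamiltonEqAt (H : PhaseSpace → ℝ) (c : ℝ → PhaseSpace) (t : ℝ) : Prop :=
  HasDerivAt (coords ∘ c) (fun i => dmom i H (c t), fun i => -dpos i H (c t)) t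

/-! ### The two-body Hamiltonian -/

/-- The kinetic energy of a velocity vector `v ∈ T_{R 0} L2 × T_{R 1} L2`, for the masses `μ`. -/
def kineticVelocity (μ : Fin 2 → ℝ) {R : Fin 2 → L2} (v : ∀ a, tangentL2 (R a)) : ℝ :=
  (1 / 2) * ∑ a, μ a * mink (v a) (v a)

/-- The kinetic energy as a function on `T*Q`: the Legendre transform of `kineticVelocity`. -/
def kinetic (μ : Fin 2 → ℝ) (z : PhaseSpace) : ℝ :=
  ⨆ v : ∀ a, tangentL2 (z.R a), (∑ a, z.α a (v a) - kineticVelocity μ v)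

/-- The Hamiltonian `H = T + U` on `T*Q`, where `U` is evaluated at the Riemannian distance of the
bodies. -/
def hamiltonian (μ : Fin 2 → ℝ) (U : ℝ → ℝ) (z : PhaseSpace) : ℝ :=
  kinetic μ z + U (riemDist (z.R 0) (z.R 1))

/-! ### The model `ℝ³ × (0, ∞) × ℝ` of the reduced space -/

/-- The ambient space `ℝ³ × ℝ × ℝ` of the points `(m, q, p)`. -/
abbrev E5 : Type := (Fin 3 → ℝ) × ℝ × ℝ

/-- The set `ℝ³ × (0, ∞) × ℝ` of the points `(m, q, p)` with `q > 0`. -/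
def reducedSet : Set E5 := {x | 0 < x.2.1}

/-- The gradient of `f` with respect to `m = (m_x, m_y, m_z)`. -/
def gradm (f : E5 → ℝ) (x : E5) : Fin 3 → ℝ := fun a => fderiv ℝ f x (Pi.single a 1, 0, 0)

/-- The partial derivative `∂f/∂q`. -/
def dq (f : E5 → ℝ) (x : E5) : ℝ := fderiv ℝ f x (0, 1, 0)

/-- The partial derivative `∂f/∂p`. -/
def dp (f : E5 → ℝ) (x : E5) : ℝ := fderiv ℝ f x (0, 0, 1)

/-- The bracket on `ℝ³ × (0, ∞) × ℝ` that is the derivation in each argument determined by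
`{m_x, m_y} = m_z`, `{m_y, m_z} = -m_x`, `{m_z, m_x} = -m_y`, `{q, p} = 1`, the other brackets of
coordinate functions being zero. -/
def reducedBracket (f g : E5 → ℝ) (x : E5) : ℝ :=
  x.1 2 * (gradm f x 0 * gradm g x 1 - gradm f x 1 * gradm g x 0)
    - x.1 0 * (gradm f x 1 * gradm g x 2 - gradm f x 2 * gradm g x 1)
    - x.1 1 * (gradm f x 2 * gradm g x 0 - gradm f x 0 * gradm g x 2)
    + (dq f x * dp g x - dp f x * dq g x)

/-- The coordinate function `m_a` on `ℝ³ × ℝ × ℝ`. -/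
def mCoord (a : Fin 3) (x : E5) : ℝ := x.1 a

/-- The coordinate function `q`. -/
def qCoord (x : E5) : ℝ := x.2.1

/-- The coordinate function `p`. -/
def pCoord (x : E5) : ℝ := x.2.2

/-- `B` is a Poisson bracket on the smooth functions on the (open) set `s`. -/
structure IsPoissonBracketOn (s : Set E5) (B : (E5 → ℝ) → (E5 → ℝ) → E5 → ℝ) : Prop where
  smooth : ∀ f g, ContDiffOn ℝ ∞ f s → ContDiffOn ℝ ∞ g s → ContDiffOn ℝ ∞ (B f g) s
  skew : ∀ f g, ContDiffOn ℝ ∞ f s → ContDiffOn ℝ ∞ g s → ∀ x ∈ s, B f g x = -B g f x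
  add : ∀ f g h, ContDiffOn ℝ ∞ f s → ContDiffOn ℝ ∞ g s → ContDiffOn ℝ ∞ h s →
    ∀ x ∈ s, B (f + g) h x = B f h x + B g h x
  smul : ∀ (c : ℝ) f g, ContDiffOn ℝ ∞ f s → ContDiffOn ℝ ∞ g s →
    ∀ x ∈ s, B (c • f) g x = c * B f g x
  leibniz : ∀ f g h, ContDiffOn ℝ ∞ f s → ContDiffOn ℝ ∞ g s → ContDiffOn ℝ ∞ h s →
    ∀ x ∈ s, B (f * g) h x = f x * B g h x + g x * B f h x
  jacobi : ∀ f g h, ContDiffOn ℝ ∞ f s → ContDiffOn ℝ ∞ g s → ContDiffOn ℝ ∞ h s →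
    ∀ x ∈ s, B f (B g h) x + B g (B h f) x + B h (B f g) x = 0

/-- `F` is a Casimir function of the bracket `B` on the smooth functions on `s`. -/
def IsCasimirOn (s : Set E5) (B : (E5 → ℝ) → (E5 → ℝ) → E5 → ℝ) (F : E5 → ℝ) : Prop :=
  ContDiffOn ℝ ∞ F s ∧ ∀ g, ContDiffOn ℝ ∞ g s → ∀ x ∈ s, B F g x = 0

/-- The function `C(m) = -⟨m, m⟩_K = -m_x² - m_y² + m_z²`. -/
def casimir (x : E5) : ℝ := -mink x.1 x.1

/-- The matrix `A(q)`, where `μ` is the mass ratio `μ₁ / μ₂`. -/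
def A (μ q : ℝ) : Matrix (Fin 3) (Fin 3) ℝ :=
  !![1, 0, 0;
     0, 1, -(Real.cosh q / Real.sinh q);
     0, -(Real.cosh q / Real.sinh q), (μ + Real.cosh q ^ 2) / Real.sinh q ^ 2]

/-- The reduced Hamiltonian
`H(m, q, p) = (1 / 2μ₁) ((m, A(q) m) - 2 m_x p + (1 + μ) p²) + U(q)`, with `μ = μ₁ / μ₂`. -/
def reducedHamiltonian (μ₁ μ₂ : ℝ) (U : ℝ → ℝ) (x : E5) : ℝ :=
  1 / (2 * μ₁) * (x.1 ⬝ᵥ (A (μ₁ / μ₂) x.2.1 *ᵥ x.1) - 2 * x.1 0 * x.2.2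
    + (1 + μ₁ / μ₂) * x.2.2 ^ 2) + U x.2.1

/-- The Hamiltonian vector field of `H` for the bracket `reducedBracket`: its components are
`{m_a, H}`, `{q, H}`, `{p, H}`. -/
def reducedVectorField (H : E5 → ℝ) (x : E5) : E5 :=
  (fun a => reducedBracket (mCoord a) H x, reducedBracket qCoord H x, reducedBracket pCoord H x)

/-! ### The Lie algebra `so(2,1)` -/

attribute [local instance 100] LieRing.ofAssociativeRing

/-- The Lie algebra `so(2,1)` of the matrices `ξ` with `ξᵀ K + K ξ = 0`, with the commutator. -/
abbrev so21 : LieSubalgebra ℝ (Matrix (Fin 3) (Fin 3) ℝ) := skewAdjointMatricesLieSubalgebra K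

/-- The matrix `ω̂ K`, where `ω̂` is the matrix of the vector product with `ω`. -/
def tilde (w : Fin 3 → ℝ) : Matrix (Fin 3) (Fin 3) ℝ :=
  !![0, -w 2, w 1; w 2, 0, -w 0; -w 1, w 0, 0] * K

end TwoBodyL2

end

attribute [local instance 100] LieRing.ofAssociativeRing

noncomputable section

namespace TwoBodyL2

/-! ### The bracket on the model of the reduced space -/

/-! Two distinct points a, b of the Lobachevsky plane carry an orthonormal frame that depends
equivariantly on them: the unit tangent `dir₁` at a towards b, its continuation `dir₂` along the
geodesic at b, and the common unit normal `normal`. The values of the covectors on this frame,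
together with the distance, are therefore invariants of the group. They are combined so that m is
the momentum map read in the frame at a: its components pair the covectors with the Killing fields
of the translation along the geodesic, of the boost in the normal direction, and of the rotation
about a. The remaining invariants are the distance q and the momentum p of the second body along the
geodesic. This is the map `reduction`, the J of the theorem.

The fibres of J are the orbits: an isometry carries a standard pair of points to the given one
(`exists_frame`), and the covectors then agree because J determines their values on the frame
(`exists_smul_reductionSection`). The section `reductionSection` is explicit and smooth, which gives
the homeomorphism and the smoothness criterion `contDiffOn_iff_comp_reduction`.

J is a Poisson map because m and p are linear in the momenta. The momentum gradient of F ∘ J is then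
a combination of four velocity fields: the three Killing fields and the motion of the second body
along the geodesic. The canonical bracket is an antisymmetrized derivative of J along these fields
(`canonicalBracket_eq`, `dmom_comp_reduction`). The four derivatives are computed by moving the
frame, and the terms that depend on the chart cancel (`canonicalBracket_comp_reduction`).

The distance is found by comparison with a 1-Lipschitz function (`riemDist_eq`), and the kinetic
energy by completing squares in the frame (`kinetic_eq`). The reduced dynamics then follows from the
Poisson property applied to the linear coordinates. The Jacobi identity and the Casimir statements
are algebra in the five partial derivatives. -/

theorem isOpen_reducedSet : IsOpen reducedSet :=
  isOpen_lt continuous_const (continuous_fst.comp continuous_snd)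

/-- The standard basis of `ℝ³ × ℝ × ℝ`. -/
def basisE5 : Fin 5 → E5 :=
  ![(Pi.single 0 1, 0, 0), (Pi.single 1 1, 0, 0), (Pi.single 2 1, 0, 0), (0, 1, 0), (0, 0, 1)]

theorem eq_sum_basisE5 (v : E5) :
    v = v.1 0 • basisE5 0 + v.1 1 • basisE5 1 + v.1 2 • basisE5 2 + v.2.1 • basisE5 3 +
      v.2.2 • basisE5 4 := by
  refine Prod.ext (funext fun i => ?_) (Prod.ext ?_ ?_)
  · fin_cases i <;> simp [basisE5]
  · simp [basisE5]
  · simp [basisE5]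

/-- The partial derivatives of a function on `ℝ³ × ℝ × ℝ`. -/
def partialE5 (i : Fin 5) (f : E5 → ℝ) (x : E5) : ℝ := fderiv ℝ f x (basisE5 i)

theorem reducedBracket_eq (f g : E5 → ℝ) (x : E5) :
    reducedBracket f g x =
      x.1 2 * (partialE5 0 f x * partialE5 1 g x - partialE5 1 f x * partialE5 0 g x)
      - x.1 0 * (partialE5 1 f x * partialE5 2 g x - partialE5 2 f x * partialE5 1 g x)
      - x.1 1 * (partialE5 2 f x * partialE5 0 g x - partialE5 0 f x * partialE5 2 g x)
      + (partialE5 3 f x * partialE5 4 g x - partialE5 4 f x * partialE5 3 g x) := rfl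

theorem fderiv_apply_eq_sum_partialE5 (f : E5 → ℝ) (x v : E5) :
    fderiv ℝ f x v = v.1 0 * partialE5 0 f x + v.1 1 * partialE5 1 f x +
      v.1 2 * partialE5 2 f x + v.2.1 * partialE5 3 f x + v.2.2 * partialE5 4 f x := by
  conv_lhs => rw [eq_sum_basisE5 v]
  simp only [map_add, map_smul, smul_eq_mul, partialE5]

theorem partialE5_add {f g : E5 → ℝ} {x : E5} (hf : DifferentiableAt ℝ f x)
    (hg : DifferentiableAt ℝ g x) (i : Fin 5) :
    partialE5 i (f + g) x = partialE5 i f x + partialE5 i g x := by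
  simp [partialE5, fderiv_add hf hg]

theorem partialE5_smul {f : E5 → ℝ} {x : E5} (hf : DifferentiableAt ℝ f x) (c : ℝ) (i : Fin 5) :
    partialE5 i (c • f) x = c * partialE5 i f x := by
  simp [partialE5, fderiv_const_smul hf c]

theorem partialE5_mul {f g : E5 → ℝ} {x : E5} (hf : DifferentiableAt ℝ f x)
    (hg : DifferentiableAt ℝ g x) (i : Fin 5) :
    partialE5 i (f * g) x = f x * partialE5 i g x + g x * partialE5 i f x := by
  simp [partialE5, fderiv_mul hf hg]

/-- The coordinate `m_a` as a continuous linear form. -/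
def mCoordL (a : Fin 3) : E5 →L[ℝ] ℝ :=
  (ContinuousLinearMap.proj a).comp (ContinuousLinearMap.fst ℝ (Fin 3 → ℝ) (ℝ × ℝ))

/-- The coordinate `q` as a continuous linear form. -/
def qCoordL : E5 →L[ℝ] ℝ :=
  (ContinuousLinearMap.fst ℝ ℝ ℝ).comp (ContinuousLinearMap.snd ℝ (Fin 3 → ℝ) (ℝ × ℝ))

/-- The coordinate `p` as a continuous linear form. -/
def pCoordL : E5 →L[ℝ] ℝ :=
  (ContinuousLinearMap.snd ℝ ℝ ℝ).comp (ContinuousLinearMap.snd ℝ (Fin 3 → ℝ) (ℝ × ℝ))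

theorem hasFDerivAt_mCoord (a : Fin 3) (x : E5) : HasFDerivAt (mCoord a) (mCoordL a) x :=
  (mCoordL a).hasFDerivAt

theorem hasFDerivAt_qCoord (x : E5) : HasFDerivAt qCoord qCoordL x := qCoordL.hasFDerivAt

theorem hasFDerivAt_pCoord (x : E5) : HasFDerivAt pCoord pCoordL x := pCoordL.hasFDerivAt

theorem partialE5_mCoord (a : Fin 3) (i : Fin 5) (x : E5) :
    partialE5 i (mCoord a) x = (basisE5 i).1 a := by
  rw [partialE5, (hasFDerivAt_mCoord a x).fderiv]; rfl

theorem partialE5_qCoord (i : Fin 5) (x : E5) : partialE5 i qCoord x = (basisE5 i).2.1 := by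
  rw [partialE5, (hasFDerivAt_qCoord x).fderiv]; rfl

theorem partialE5_pCoord (i : Fin 5) (x : E5) : partialE5 i pCoord x = (basisE5 i).2.2 := by
  rw [partialE5, (hasFDerivAt_pCoord x).fderiv]; rfl

theorem contDiff_mCoord (a : Fin 3) : ContDiff ℝ ∞ (mCoord a) := (mCoordL a).contDiff

theorem contDiff_qCoord : ContDiff ℝ ∞ qCoord := qCoordL.contDiff

theorem contDiff_pCoord : ContDiff ℝ ∞ pCoord := pCoordL.contDiff

theorem reducedBracket_coord (x : E5) :
    reducedBracket (mCoord 0) (mCoord 1) x = mCoord 2 x ∧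
      reducedBracket (mCoord 1) (mCoord 2) x = -mCoord 0 x ∧
      reducedBracket (mCoord 2) (mCoord 0) x = -mCoord 1 x ∧
      reducedBracket qCoord pCoord x = 1 ∧
      ∀ a, reducedBracket (mCoord a) qCoord x = 0 ∧ reducedBracket (mCoord a) pCoord x = 0 := by
  simp only [reducedBracket_eq, partialE5_mCoord, partialE5_qCoord, partialE5_pCoord]
  refine ⟨?_, ?_, ?_, ?_, fun a => ⟨?_, ?_⟩⟩ <;> simp [basisE5, mCoord]

theorem contDiffOn_partialE5 {f : E5 → ℝ} (hf : ContDiffOn ℝ ∞ f reducedSet) (i : Fin 5) :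
    ContDiffOn ℝ ∞ (partialE5 i f) reducedSet :=
  (hf.fderiv_of_isOpen isOpen_reducedSet (by simp)).clm_apply contDiffOn_const

theorem differentiableAt_of_contDiffOn_reducedSet {f : E5 → ℝ} (hf : ContDiffOn ℝ ∞ f reducedSet)
    {x : E5} (hx : x ∈ reducedSet) : DifferentiableAt ℝ f x :=
  (hf.contDiffAt (isOpen_reducedSet.mem_nhds hx)).differentiableAt (by simp)

theorem contDiffOn_reducedBracket {f g : E5 → ℝ} (hf : ContDiffOn ℝ ∞ f reducedSet)
    (hg : ContDiffOn ℝ ∞ g reducedSet) : ContDiffOn ℝ ∞ (reducedBracket f g) reducedSet := by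
  have hf' := contDiffOn_partialE5 hf
  have hg' := contDiffOn_partialE5 hg
  have hm : ∀ a : Fin 3, ContDiffOn ℝ ∞ (fun x : E5 => x.1 a) reducedSet :=
    fun a => (contDiff_mCoord a).contDiffOn
  exact ((((hm 2).mul (((hf' 0).mul (hg' 1)).sub ((hf' 1).mul (hg' 0)))).sub
    ((hm 0).mul (((hf' 1).mul (hg' 2)).sub ((hf' 2).mul (hg' 1))))).sub
    ((hm 1).mul (((hf' 2).mul (hg' 0)).sub ((hf' 0).mul (hg' 2))))).add
    (((hf' 3).mul (hg' 4)).sub ((hf' 4).mul (hg' 3)))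

theorem partialE5_comm {f : E5 → ℝ} (hf : ContDiffOn ℝ ∞ f reducedSet) {x : E5}
    (hx : x ∈ reducedSet) (i j : Fin 5) :
    partialE5 i (partialE5 j f) x = partialE5 j (partialE5 i f) x := by
  have hc := hf.contDiffAt (isOpen_reducedSet.mem_nhds hx)
  have hd : DifferentiableAt ℝ (fderiv ℝ f) x :=
    ((hf.fderiv_of_isOpen (m := ∞) isOpen_reducedSet (by simp)).contDiffAt
      (isOpen_reducedSet.mem_nhds hx)).differentiableAt (by simp)
  have key : ∀ k l : Fin 5, partialE5 k (partialE5 l f) x =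
      fderiv ℝ (fderiv ℝ f) x (basisE5 k) (basisE5 l) := by
    intro k l
    have h : HasFDerivAt (partialE5 l f)
        ((fderiv ℝ (fderiv ℝ f) x).flip (basisE5 l)) x := by
      refine (hd.hasFDerivAt.clm_apply (hasFDerivAt_const (basisE5 l) x)).congr_fderiv ?_
      simp
    rw [partialE5, h.fderiv]; rfl
  rw [key, key]
  exact hc.isSymmSndFDerivAt (by simpa using WithTop.coe_le_coe.2 (le_top : (2 : ℕ∞) ≤ ⊤)) _ _

/-- The coefficients of the bracket are linear in m, so their derivatives are constants and form the
first group of terms; all other terms contain a second derivative of f or g. -/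
theorem partialE5_reducedBracket {f g : E5 → ℝ} (hf : ContDiffOn ℝ ∞ f reducedSet)
    (hg : ContDiffOn ℝ ∞ g reducedSet) {x : E5} (hx : x ∈ reducedSet) (i : Fin 5) :
    partialE5 i (reducedBracket f g) x =
      (basisE5 i).1 2 * (partialE5 0 f x * partialE5 1 g x - partialE5 1 f x * partialE5 0 g x)
      - (basisE5 i).1 0 * (partialE5 1 f x * partialE5 2 g x - partialE5 2 f x * partialE5 1 g x)
      - (basisE5 i).1 1 * (partialE5 2 f x * partialE5 0 g x - partialE5 0 f x * partialE5 2 g x)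
      + (x.1 2 * (partialE5 i (partialE5 0 f) x * partialE5 1 g x +
            partialE5 0 f x * partialE5 i (partialE5 1 g) x -
            partialE5 i (partialE5 1 f) x * partialE5 0 g x -
            partialE5 1 f x * partialE5 i (partialE5 0 g) x)
        - x.1 0 * (partialE5 i (partialE5 1 f) x * partialE5 2 g x +
            partialE5 1 f x * partialE5 i (partialE5 2 g) x -
            partialE5 i (partialE5 2 f) x * partialE5 1 g x -
            partialE5 2 f x * partialE5 i (partialE5 1 g) x)
        - x.1 1 * (partialE5 i (partialE5 2 f) x * partialE5 0 g x +
            partialE5 2 f x * partialE5 i (partialE5 0 g) x -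
            partialE5 i (partialE5 0 f) x * partialE5 2 g x -
            partialE5 0 f x * partialE5 i (partialE5 2 g) x)
        + (partialE5 i (partialE5 3 f) x * partialE5 4 g x +
            partialE5 3 f x * partialE5 i (partialE5 4 g) x -
            partialE5 i (partialE5 4 f) x * partialE5 3 g x -
            partialE5 4 f x * partialE5 i (partialE5 3 g) x)) := by
  have hf' := fun j =>
    (differentiableAt_of_contDiffOn_reducedSet (contDiffOn_partialE5 hf j) hx).hasFDerivAt
  have hg' := fun j =>
    (differentiableAt_of_contDiffOn_reducedSet (contDiffOn_partialE5 hg j) hx).hasFDerivAt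
  have hm : ∀ a : Fin 3, HasFDerivAt (fun x : E5 => x.1 a) (mCoordL a) x :=
    fun a => hasFDerivAt_mCoord a x
  have H := ((((hm 2).mul (((hf' 0).mul (hg' 1)).sub ((hf' 1).mul (hg' 0)))).sub
    ((hm 0).mul (((hf' 1).mul (hg' 2)).sub ((hf' 2).mul (hg' 1))))).sub
    ((hm 1).mul (((hf' 2).mul (hg' 0)).sub ((hf' 0).mul (hg' 2))))).add
    (((hf' 3).mul (hg' 4)).sub ((hf' 4).mul (hg' 3)))
  have H2 : partialE5 i (reducedBracket f g) x = _ :=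
    congrArg (fun L : E5 →L[ℝ] ℝ => L (basisE5 i)) (HasFDerivAt.fderiv (f := reducedBracket f g) H)
  have e : ∀ a, mCoordL a (basisE5 i) = (basisE5 i).1 a := fun a => rfl
  have e2 : ∀ j (h : E5 → ℝ), fderiv ℝ (partialE5 j h) x (basisE5 i) =
    partialE5 i (partialE5 j h) x := fun j h => rfl
  rw [H2]
  simp only [_root_.add_apply, _root_.sub_apply,
    _root_.smul_apply, smul_eq_mul, e, e2, Pi.sub_apply, Pi.mul_apply]
  ring

/-- Once mixed partials commute, this is a polynomial identity: the terms with second derivatives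
cancel in the cyclic sum, and those with only first derivatives cancel by the Jacobi identity of the
structure constants. -/
theorem reducedBracket_jacobi {f g h : E5 → ℝ} (hf : ContDiffOn ℝ ∞ f reducedSet)
    (hg : ContDiffOn ℝ ∞ g reducedSet) (hh : ContDiffOn ℝ ∞ h reducedSet) {x : E5}
    (hx : x ∈ reducedSet) :
    reducedBracket f (reducedBracket g h) x + reducedBracket g (reducedBracket h f) x +
      reducedBracket h (reducedBracket f g) x = 0 := by
  rw [reducedBracket_eq f, reducedBracket_eq g, reducedBracket_eq h]
  simp only [partialE5_reducedBracket hf hg hx, partialE5_reducedBracket hg hh hx,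
    partialE5_reducedBracket hh hf hx]
  have hs : ∀ k : E5 → ℝ, ContDiffOn ℝ ∞ k reducedSet →
      partialE5 1 (partialE5 0 k) x = partialE5 0 (partialE5 1 k) x ∧
      partialE5 2 (partialE5 0 k) x = partialE5 0 (partialE5 2 k) x ∧
      partialE5 3 (partialE5 0 k) x = partialE5 0 (partialE5 3 k) x ∧
      partialE5 4 (partialE5 0 k) x = partialE5 0 (partialE5 4 k) x ∧
      partialE5 2 (partialE5 1 k) x = partialE5 1 (partialE5 2 k) x ∧
      partialE5 3 (partialE5 1 k) x = partialE5 1 (partialE5 3 k) x ∧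
      partialE5 4 (partialE5 1 k) x = partialE5 1 (partialE5 4 k) x ∧
      partialE5 3 (partialE5 2 k) x = partialE5 2 (partialE5 3 k) x ∧
      partialE5 4 (partialE5 2 k) x = partialE5 2 (partialE5 4 k) x ∧
      partialE5 4 (partialE5 3 k) x = partialE5 3 (partialE5 4 k) x := fun k hk =>
    ⟨partialE5_comm hk hx _ _, partialE5_comm hk hx _ _, partialE5_comm hk hx _ _,
      partialE5_comm hk hx _ _, partialE5_comm hk hx _ _, partialE5_comm hk hx _ _,
      partialE5_comm hk hx _ _, partialE5_comm hk hx _ _, partialE5_comm hk hx _ _,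
      partialE5_comm hk hx _ _⟩
  -- All mixed partials are brought to one order of indices, so that `ring` sees them as the same
  -- atoms.
  simp only [hs f hf, hs g hg, hs h hh]
  simp only [basisE5, Matrix.cons_val, Pi.single_apply, Pi.zero_apply]
  simp only [Fin.reduceEq, if_true, if_false]
  ring

theorem isPoissonBracketOn_reducedBracket : IsPoissonBracketOn reducedSet reducedBracket where
  smooth _ _ hf hg := contDiffOn_reducedBracket hf hg
  skew f g _ _ x _ := by rw [reducedBracket_eq, reducedBracket_eq]; ring
  add f g h hf hg _ x hx := by
    simp only [reducedBracket_eq, partialE5_add (differentiableAt_of_contDiffOn_reducedSet hf hx)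
      (differentiableAt_of_contDiffOn_reducedSet hg hx)]
    ring
  smul c f g hf _ x hx := by
    simp only [reducedBracket_eq, partialE5_smul (differentiableAt_of_contDiffOn_reducedSet hf hx)]
    ring
  leibniz f g h hf hg _ x hx := by
    simp only [reducedBracket_eq, partialE5_mul (differentiableAt_of_contDiffOn_reducedSet hf hx)
      (differentiableAt_of_contDiffOn_reducedSet hg hx)]
    ring
  jacobi _ _ _ hf hg hh _ hx := reducedBracket_jacobi hf hg hh hx

/-! ### The Lie algebra `so(2,1)` -/

theorem tilde_eq (w : Fin 3 → ℝ) :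
    tilde w = !![0, -w 2, -w 1; w 2, 0, w 0; -w 1, w 0, 0] := by
  ext i j
  fin_cases i <;> fin_cases j <;> simp [tilde, K]

theorem mem_so21_iff {M : Matrix (Fin 3) (Fin 3) ℝ} : M ∈ so21 ↔ Mᵀ * K = K * -M := by
  rw [mem_skewAdjointMatricesLieSubalgebra, mem_skewAdjointMatricesSubmodule]
  rfl

theorem tilde_mem (w : Fin 3 → ℝ) : tilde w ∈ so21 := by
  rw [mem_so21_iff, tilde_eq]
  ext i j
  fin_cases i <;> fin_cases j <;> simp [K]

/-- The isomorphism of `ℝ³` and `so(2,1)` given by `tilde`. -/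
def tildeEquiv : (Fin 3 → ℝ) ≃ₗ[ℝ] so21 where
  toFun w := ⟨tilde w, tilde_mem w⟩
  map_add' u v := by
    ext i j
    simp only [tilde_eq]
    fin_cases i <;> fin_cases j <;> simp <;> ring
  map_smul' c v := by
    ext i j
    simp only [tilde_eq]
    fin_cases i <;> fin_cases j <;> simp
  invFun M := ![M.1 1 2, -M.1 2 0, M.1 1 0]
  left_inv w := by
    ext i
    fin_cases i <;> simp [tilde_eq]
  right_inv M := by
    obtain ⟨M, hM⟩ := M
    rw [mem_so21_iff] at hM
    have h : ∀ i j, (Mᵀ * K) i j = (K * -M) i j := fun i j => by rw [hM]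
    simp [K, Fin.forall_fin_succ] at h
    ext i j
    simp only [tilde_eq]
    fin_cases i <;> fin_cases j <;> simp <;> linarith

/-- Under `tildeEquiv` the commutator becomes the product K(u × v) on ℝ³, whose components are the
structure constants of the bracket. -/
theorem reducedBracket_eq_liePoisson (f g : E5 → ℝ) (x : E5) :
    reducedBracket f g x =
      -(x.1 ⬝ᵥ tildeEquiv.symm ⁅tildeEquiv (gradm f x), tildeEquiv (gradm g x)⁆)
        + (dq f x * dp g x - dp f x * dq g x) := by
  rw [reducedBracket]
  simp only [tildeEquiv, LinearEquiv.coe_symm_mk, LinearEquiv.coe_mk, LinearMap.coe_mk,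
    AddHom.coe_mk, LieSubalgebra.coe_bracket, Ring.lie_def, tilde_eq, dotProduct,
    Fin.sum_univ_three]
  simp
  ring

/-! ### Casimir functions -/

theorem casimir_eq (x : E5) : casimir x = -(x.1 0 * x.1 0) - x.1 1 * x.1 1 + x.1 2 * x.1 2 := by
  rw [casimir, mink_eq]; ring

theorem hasFDerivAt_casimir (x : E5) :
    HasFDerivAt casimir ((-2 * x.1 0) • mCoordL 0 + (-2 * x.1 1) • mCoordL 1 +
      (2 * x.1 2) • mCoordL 2) x := by
  have hm : ∀ a : Fin 3, HasFDerivAt (fun x : E5 => x.1 a) (mCoordL a) x :=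
    fun a => hasFDerivAt_mCoord a x
  have h := (((hm 0).mul (hm 0)).neg.sub ((hm 1).mul (hm 1))).add ((hm 2).mul (hm 2))
  have e : casimir = _ := funext casimir_eq
  rw [e]
  refine h.congr_fderiv ?_
  ext v <;> simp <;> ring

theorem partialE5_casimir (x : E5) (i : Fin 5) :
    partialE5 i casimir x = -2 * x.1 0 * (basisE5 i).1 0 + -2 * x.1 1 * (basisE5 i).1 1 +
      2 * x.1 2 * (basisE5 i).1 2 := by
  rw [partialE5, (hasFDerivAt_casimir x).fderiv]; rfl

theorem isCasimirOn_casimir : IsCasimirOn reducedSet reducedBracket casimir := by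
  refine ⟨ContDiff.contDiffOn ?_, fun g _ x _ => ?_⟩
  · rw [show casimir = _ from funext casimir_eq]
    fun_prop
  · simp only [reducedBracket_eq, partialE5_casimir]
    simp [basisE5]
    ring

/-- It suffices to test F against the coordinates. The brackets with q and p annihilate ∂F/∂p and
∂F/∂q; those with the m_a say that the m-gradient of F has vanishing vector product with (-m_x,
-m_y, m_z), hence is proportional to it where m ≠ 0. -/
theorem IsCasimirOn.exists_fderiv_eq_smul {F : E5 → ℝ}
    (hF : IsCasimirOn reducedSet reducedBracket F) {x : E5} (hx : x ∈ reducedSet)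
    (hm : x.1 ≠ 0) : ∃ l : ℝ, fderiv ℝ F x = l • fderiv ℝ casimir x := by
  have h0 := hF.2 _ (contDiff_mCoord 0).contDiffOn x hx
  have h1 := hF.2 _ (contDiff_mCoord 1).contDiffOn x hx
  have h2 := hF.2 _ (contDiff_mCoord 2).contDiffOn x hx
  have h3 := hF.2 _ contDiff_qCoord.contDiffOn x hx
  have h4 := hF.2 _ contDiff_pCoord.contDiffOn x hx
  simp only [reducedBracket_eq, partialE5_mCoord, partialE5_qCoord, partialE5_pCoord] at *
  simp [basisE5] at h0 h1 h2 h3 h4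
  have key : ∃ l : ℝ, partialE5 0 F x = l * (-2 * x.1 0) ∧ partialE5 1 F x = l * (-2 * x.1 1) ∧
      partialE5 2 F x = l * (2 * x.1 2) := by
    have hne : x.1 0 ≠ 0 ∨ x.1 1 ≠ 0 ∨ x.1 2 ≠ 0 := by
      by_contra hcon
      push Not at hcon
      refine hm (funext fun i => ?_)
      fin_cases i
      exacts [hcon.1, hcon.2.1, hcon.2.2]
    -- The multiplier is read off from a component of m that does not vanish.
    rcases hne with h | h | h
    · refine ⟨partialE5 0 F x / (-2 * x.1 0), ?_, ?_, ?_⟩ <;> field_simp <;> linarith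
    · refine ⟨partialE5 1 F x / (-2 * x.1 1), ?_, ?_, ?_⟩ <;> field_simp <;> linarith
    · refine ⟨partialE5 2 F x / (2 * x.1 2), ?_, ?_, ?_⟩ <;> field_simp <;> linarith
  obtain ⟨l, hl0, hl1, hl2⟩ := key
  refine ⟨l, ContinuousLinearMap.ext fun v => ?_⟩
  rw [_root_.smul_apply, fderiv_apply_eq_sum_partialE5 F x v,
    (hasFDerivAt_casimir x).fderiv, hl0, hl1, hl2, h3, h4]
  change _ = l • ((-2 * x.1 0) * v.1 0 + (-2 * x.1 1) * v.1 1 + (2 * x.1 2) * v.1 2)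
  rw [smul_eq_mul]
  ring

/-! ### Minkowski geometry -/

theorem mink_comm (u v : Fin 3 → ℝ) : mink u v = mink v u := by
  rw [mink_eq, mink_eq]; ring

theorem mink_add_left (u v w : Fin 3 → ℝ) : mink (u + v) w = mink u w + mink v w := by
  simp only [mink_eq, Pi.add_apply]; ring

theorem mink_sub_left (u v w : Fin 3 → ℝ) : mink (u - v) w = mink u w - mink v w := by
  simp only [mink_eq, Pi.sub_apply]; ring

theorem mink_smul_left (c : ℝ) (u w : Fin 3 → ℝ) : mink (c • u) w = c * mink u w := by
  simp only [mink_eq, Pi.smul_apply, smul_eq_mul]; ring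

theorem mink_add_right (u v w : Fin 3 → ℝ) : mink w (u + v) = mink w u + mink w v := by
  simp only [mink_eq, Pi.add_apply]; ring

theorem mink_sub_right (u v w : Fin 3 → ℝ) : mink w (u - v) = mink w u - mink w v := by
  simp only [mink_eq, Pi.sub_apply]; ring

theorem mink_smul_right (c : ℝ) (u w : Fin 3 → ℝ) : mink w (c • u) = c * mink w u := by
  simp only [mink_eq, Pi.smul_apply, smul_eq_mul]; ring

/-- The vector product of Minkowski space: `K (u × v)`. -/
def mcross (u v : Fin 3 → ℝ) : Fin 3 → ℝ :=
  ![u 1 * v 2 - u 2 * v 1, u 2 * v 0 - u 0 * v 2, -(u 0 * v 1 - u 1 * v 0)]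

theorem mink_mcross_self_left (u v : Fin 3 → ℝ) : mink (mcross u v) u = 0 := by
  simp [mink_eq, mcross]; ring

theorem mink_mcross_self_right (u v : Fin 3 → ℝ) : mink (mcross u v) v = 0 := by
  simp [mink_eq, mcross]; ring

theorem mink_mcross_mcross (u v : Fin 3 → ℝ) :
    mink (mcross u v) (mcross u v) = mink u v ^ 2 - mink u u * mink v v := by
  simp [mink_eq, mcross]; ring

theorem mcross_mcross_right (u v w : Fin 3 → ℝ) :
    mcross u (mcross v w) = mink u v • w - mink u w • v := by
  ext i
  fin_cases i <;> simp [mink_eq, mcross] <;> ring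

theorem mcross_self (u : Fin 3 → ℝ) : mcross u u = 0 := by
  ext i
  fin_cases i <;> simp [mcross] <;> ring

theorem mcross_anticomm (u v : Fin 3 → ℝ) : mcross u v = -mcross v u := by
  ext i
  fin_cases i <;> simp [mcross] <;> ring

theorem mcross_smul_right (c : ℝ) (u v : Fin 3 → ℝ) : mcross u (c • v) = c • mcross u v := by
  ext i
  fin_cases i <;> simp [mcross] <;> ring

theorem mcross_smul_left (c : ℝ) (u v : Fin 3 → ℝ) : mcross (c • u) v = c • mcross u v := by
  ext i
  fin_cases i <;> simp [mcross] <;> ring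

theorem mcross_sub_right (u v w : Fin 3 → ℝ) : mcross u (v - w) = mcross u v - mcross u w := by
  ext i
  fin_cases i <;> simp [mcross] <;> ring

theorem mink_mcross_eq_det (u v w : Fin 3 → ℝ) :
    mink (mcross u v) w = (Matrix.of ![u, v, w]).det := by
  simp [mink_eq, mcross, Matrix.det_fin_three]; ring

theorem eq_of_mink_eq {u v : Fin 3 → ℝ} (h : ∀ w, mink u w = mink v w) : u = v := by
  ext i
  have h' := h (Pi.single i 1)
  simp only [mink_eq] at h'
  fin_cases i <;> simpa using h'

/-- The pairing of the product with a third vector is a determinant, which g preserves because det g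
= 1; the form is nondegenerate, so the vectors themselves agree. -/
theorem mcross_act (g : SO21) (u v : Fin 3 → ℝ) :
    mcross (act g u) (act g v) = act g (mcross u v) := by
  refine eq_of_mink_eq fun w => ?_
  rw [← act_act_inv g w, mink_act, mink_mcross_eq_det, mink_mcross_eq_det]
  have h : (Matrix.of ![act g u, act g v, act g (act g⁻¹ w)] : Matrix (Fin 3) (Fin 3) ℝ) =
      Matrix.of ![u, v, act g⁻¹ w] * (g.1.1)ᵀ := by
    ext i j
    fin_cases i <;>
      simp [act, Matrix.mul_apply, Matrix.mulVec, dotProduct, Fin.sum_univ_three] <;> ring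
  rw [h, Matrix.det_mul, Matrix.det_transpose, g.1.2, mul_one]

theorem act_sub (g : SO21) (u v : Fin 3 → ℝ) : act g (u - v) = act g u - act g v :=
  Matrix.mulVec_sub _ _ _

theorem act_smul (g : SO21) (c : ℝ) (v : Fin 3 → ℝ) : act g (c • v) = c • act g v :=
  Matrix.mulVec_smul _ _ _

/-- The tangent spaces of `L2` are spacelike. -/
theorem mink_self_pos_of_tangent {c v : Fin 3 → ℝ} (hc : c ∈ L2) (hv : mink c v = 0)
    (h0 : v ≠ 0) : 0 < mink v v := by
  obtain ⟨h1, h2⟩ := hc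
  rw [mink_eq] at *
  -- Tangency eliminates v 2, and by Lagrange's identity the two sides differ by (c 0 * v 1 - c 1 *
  -- v 0) ^ 2.
  have key : v 0 ^ 2 + v 1 ^ 2 ≤ c 2 ^ 2 * (v 0 * v 0 + v 1 * v 1 - v 2 * v 2) := by
    have e : c 2 * v 2 = c 0 * v 0 + c 1 * v 1 := by linarith
    have e2 : c 2 ^ 2 = 1 + c 0 ^ 2 + c 1 ^ 2 := by linarith
    have e3 : c 2 ^ 2 * (v 2 * v 2) = (c 0 * v 0 + c 1 * v 1) ^ 2 := by rw [← e]; ring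
    rw [mul_sub, e3, e2]
    nlinarith [sq_nonneg (c 0 * v 1 - c 1 * v 0)]
  have hpos : 0 < v 0 ^ 2 + v 1 ^ 2 := by
    by_contra hn
    have a0 : v 0 = 0 := by nlinarith [sq_nonneg (v 0), sq_nonneg (v 1)]
    have a1 : v 1 = 0 := by nlinarith [sq_nonneg (v 0), sq_nonneg (v 1)]
    have a2 : v 2 = 0 := by
      rw [a0, a1] at hv
      have : c 2 * v 2 = 0 := by linarith
      exact (mul_eq_zero.1 this).resolve_left h2.ne'
    refine h0 (funext fun i => ?_)
    fin_cases i
    exacts [a0, a1, a2]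
  exact pos_of_mul_pos_right (hpos.trans_le key) (sq_nonneg _)

theorem mink_self_nonneg_of_tangent {c v : Fin 3 → ℝ} (hc : c ∈ L2) (hv : mink c v = 0) :
    0 ≤ mink v v := by
  rcases eq_or_ne v 0 with rfl | h
  · simp [mink_eq]
  · exact (mink_self_pos_of_tangent hc hv h).le

/-- Cauchy–Schwarz in a tangent plane, where the form is positive definite. -/
theorem mink_sq_le_of_tangent {c u v : Fin 3 → ℝ} (hc : c ∈ L2) (hu : mink c u = 0)
    (hv : mink c v = 0) : mink u v ^ 2 ≤ mink u u * mink v v := by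
  rcases eq_or_ne v 0 with rfl | h
  · simp [mink_eq]
  have hp := mink_self_pos_of_tangent hc hv h
  have hw : mink c (mink v v • u - mink u v • v) = 0 := by
    rw [mink_sub_right, mink_smul_right, mink_smul_right, hu, hv]; ring
  have h1 := mink_self_nonneg_of_tangent hc hw
  simp only [mink_sub_right, mink_smul_right, mink_sub_left, mink_smul_left] at h1
  rw [mink_comm v u] at h1
  have h2 : 0 ≤ mink v v * (mink u u * mink v v - mink u v ^ 2) := by linarith
  have := nonneg_of_mul_nonneg_right h2 hp
  linarith

/-- A tangent v pairs with n as with the projection n + ⟨n, c⟩ c of n to the tangent plane, whose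
square is 1 + ⟨n, c⟩². This is the Lipschitz estimate behind the distance formula. -/
theorem mink_sq_le_of_unit {c n v : Fin 3 → ℝ} (hc : c ∈ L2) (hn : mink n n = 1)
    (hv : mink c v = 0) : mink n v ^ 2 ≤ (1 + mink n c ^ 2) * mink v v := by
  have hu : mink c (n + mink n c • c) = 0 := by
    rw [mink_add_right, mink_smul_right, hc.1, mink_comm c n]; ring
  have h := mink_sq_le_of_tangent hc hu hv
  simp only [mink_add_right, mink_smul_right, mink_add_left, mink_smul_left] at h
  rw [hv, hc.1, hn, mink_comm c n] at h
  linarith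

/-! ### Pairs of points of the Lobachevsky plane -/

/-- The hyperbolic cosine of the distance. -/
def chDist (a b : Fin 3 → ℝ) : ℝ := -mink a b

/-- The hyperbolic sine of the distance. -/
def shDist (a b : Fin 3 → ℝ) : ℝ := Real.sqrt (chDist a b ^ 2 - 1)

/-- The unit tangent vector at `a` that points towards `b`. -/
def dir₁ (a b : Fin 3 → ℝ) : Fin 3 → ℝ := (shDist a b)⁻¹ • (b - chDist a b • a)

/-- The unit tangent vector at `b` that points away from `a`. -/
def dir₂ (a b : Fin 3 → ℝ) : Fin 3 → ℝ := (shDist a b)⁻¹ • (chDist a b • b - a)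

/-- The unit normal vector of the geodesic through `a` and `b`. -/
def normal (a b : Fin 3 → ℝ) : Fin 3 → ℝ := (shDist a b)⁻¹ • mcross a b

theorem one_lt_chDist {R S : L2} (h : R ≠ S) : 1 < chDist R S := by
  have hR := R.2.1
  have hS := S.2.1
  have hp := mul_pos R.2.2 S.2.2
  rw [mink_eq] at hR hS
  rw [chDist, mink_eq]
  set a : Fin 3 → ℝ := R.1
  set b : Fin 3 → ℝ := S.1
  have e1 : a 2 ^ 2 = 1 + a 0 ^ 2 + a 1 ^ 2 := by linarith
  have e2 : b 2 ^ 2 = 1 + b 0 ^ 2 + b 1 ^ 2 := by linarith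
  have hpos : 0 < (a 0 - b 0) ^ 2 + (a 1 - b 1) ^ 2 := by
    by_contra hn
    refine h (L2_ext ?_ ?_)
    · change a 0 = b 0
      nlinarith [sq_nonneg (a 0 - b 0), sq_nonneg (a 1 - b 1)]
    · change a 1 = b 1
      nlinarith [sq_nonneg (a 0 - b 0), sq_nonneg (a 1 - b 1)]
  -- The difference of the two sides is the squared distance of the projections to the (X, Y)-plane
  -- plus (a 0 * b 1 - a 1 * b 0) ^ 2.
  have key : (1 + a 0 * b 0 + a 1 * b 1) ^ 2 < (a 2 * b 2) ^ 2 := by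
    rw [mul_pow, e1, e2]
    nlinarith [sq_nonneg (a 0 * b 1 - a 1 * b 0)]
  have := (abs_lt.1 (abs_lt_of_sq_lt_sq key hp.le)).2
  linarith

/-- A unit timelike vector is on the upper sheet if its product with a point of the upper sheet is
negative. -/
theorem mem_L2_of_mink_neg {a b : Fin 3 → ℝ} (ha : mink a a = -1) (hb : b ∈ L2)
    (h : mink a b < 0) : a ∈ L2 := by
  refine ⟨ha, ?_⟩
  obtain ⟨hb1, hb2⟩ := hb
  rw [mink_eq] at *
  -- The last coordinates dominate, so the sign of ⟨a, b⟩ is that of -(a 2 * b 2).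
  have key : (a 0 * b 0 + a 1 * b 1) ^ 2 < (a 2 * b 2) ^ 2 := by
    have e1 : a 2 ^ 2 = 1 + a 0 ^ 2 + a 1 ^ 2 := by linarith
    have e2 : b 2 ^ 2 = 1 + b 0 ^ 2 + b 1 ^ 2 := by linarith
    rw [mul_pow, e1, e2]
    nlinarith [sq_nonneg (a 0 * b 1 - a 1 * b 0), sq_nonneg (a 0), sq_nonneg (a 1),
      sq_nonneg (b 0), sq_nonneg (b 1)]
  have h2 : 0 < a 2 * b 2 := by
    by_contra hn
    nlinarith
  exact pos_of_mul_pos_left h2 hb2.le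

/-- `a` and `b` lie on the hyperboloid of unit timelike vectors, on the same sheet, and are
distinct. -/
structure IsPair (a b : Fin 3 → ℝ) : Prop where
  left : mink a a = -1
  right : mink b b = -1
  one_lt : 1 < chDist a b

theorem isPair_of_ne {R S : L2} (h : R ≠ S) : IsPair R S := ⟨R.2.1, S.2.1, one_lt_chDist h⟩

namespace IsPair

variable {a b : Fin 3 → ℝ}

theorem shDist_pos (h : IsPair a b) : 0 < shDist a b :=
  Real.sqrt_pos.2 (by nlinarith [h.one_lt])

theorem shDist_ne_zero (h : IsPair a b) : shDist a b ≠ 0 := h.shDist_pos.ne'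

theorem shDist_sq (h : IsPair a b) : shDist a b ^ 2 = chDist a b ^ 2 - 1 :=
  Real.sq_sqrt (by nlinarith [h.one_lt])

theorem cosh_arsinh_shDist (h : IsPair a b) :
    Real.cosh (Real.arsinh (shDist a b)) = chDist a b := by
  rw [Real.cosh_arsinh, h.shDist_sq, add_sub_cancel, Real.sqrt_sq (by linarith [h.one_lt])]

theorem mink_left_right (_ : IsPair a b) : mink a b = -chDist a b := by rw [chDist, neg_neg]

theorem mink_right_left (_ : IsPair a b) : mink b a = -chDist a b := by
  rw [chDist, neg_neg, mink_comm]

theorem mink_left_dir₁ (h : IsPair a b) : mink a (dir₁ a b) = 0 := by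
  rw [dir₁, mink_smul_right, mink_sub_right, mink_smul_right, h.left, h.mink_left_right]; ring

theorem mink_right_dir₁ (h : IsPair a b) : mink b (dir₁ a b) = shDist a b := by
  rw [dir₁, mink_smul_right, mink_sub_right, mink_smul_right, h.right, h.mink_right_left,
    inv_mul_eq_iff_eq_mul₀ h.shDist_ne_zero, ← sq, h.shDist_sq]
  ring

theorem mink_right_dir₂ (h : IsPair a b) : mink b (dir₂ a b) = 0 := by
  rw [dir₂, mink_smul_right, mink_sub_right, mink_smul_right, h.right, h.mink_right_left]; ring

theorem mink_left_dir₂ (h : IsPair a b) : mink a (dir₂ a b) = -shDist a b := by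
  rw [dir₂, mink_smul_right, mink_sub_right, mink_smul_right, h.left, h.mink_left_right,
    inv_mul_eq_iff_eq_mul₀ h.shDist_ne_zero]
  linear_combination h.shDist_sq

theorem mink_left_normal (_ : IsPair a b) : mink a (normal a b) = 0 := by
  rw [normal, mink_smul_right, mink_comm, mink_mcross_self_left, mul_zero]

theorem mink_right_normal (_ : IsPair a b) : mink b (normal a b) = 0 := by
  rw [normal, mink_smul_right, mink_comm, mink_mcross_self_right, mul_zero]

theorem mink_dir₁_dir₁ (h : IsPair a b) : mink (dir₁ a b) (dir₁ a b) = 1 := by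
  rw [dir₁, mink_smul_left, mink_sub_left, mink_smul_left, ← dir₁, h.mink_left_dir₁,
    h.mink_right_dir₁, mul_zero, sub_zero, inv_mul_cancel₀ h.shDist_ne_zero]

theorem mink_dir₂_dir₂ (h : IsPair a b) : mink (dir₂ a b) (dir₂ a b) = 1 := by
  rw [dir₂, mink_smul_left, mink_sub_left, mink_smul_left, ← dir₂, h.mink_left_dir₂,
    h.mink_right_dir₂, mul_zero, zero_sub, neg_neg, inv_mul_cancel₀ h.shDist_ne_zero]

theorem mink_dir₁_normal (h : IsPair a b) : mink (dir₁ a b) (normal a b) = 0 := by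
  rw [dir₁, mink_smul_left, mink_sub_left, mink_smul_left, h.mink_left_normal,
    h.mink_right_normal]
  ring

theorem mink_dir₂_normal (h : IsPair a b) : mink (dir₂ a b) (normal a b) = 0 := by
  rw [dir₂, mink_smul_left, mink_sub_left, mink_smul_left, h.mink_left_normal,
    h.mink_right_normal]
  ring

theorem mink_normal_normal (h : IsPair a b) : mink (normal a b) (normal a b) = 1 := by
  have hs := h.shDist_ne_zero
  rw [normal, mink_smul_left, mink_smul_right, mink_mcross_mcross, h.left, h.right,
    h.mink_left_right, show (-chDist a b) ^ 2 - -1 * -1 = shDist a b ^ 2 by rw [h.shDist_sq]; ring]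
  field_simp

theorem right_eq (h : IsPair a b) : b = shDist a b • dir₁ a b + chDist a b • a := by
  rw [dir₁, smul_inv_smul₀ h.shDist_ne_zero]
  abel

theorem dir₂_eq (h : IsPair a b) : dir₂ a b = chDist a b • dir₁ a b + shDist a b • a := by
  rw [dir₂, inv_smul_eq_iff₀ h.shDist_ne_zero, smul_add, smul_smul (shDist a b) (shDist a b), ← sq,
    h.shDist_sq, smul_comm, dir₁, smul_inv_smul₀ h.shDist_ne_zero]
  module

theorem mcross_normal_dir₁ (h : IsPair a b) : mcross (normal a b) (dir₁ a b) = a := by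
  rw [mcross_anticomm, normal, mcross_smul_right, mcross_mcross_right, mink_comm _ a,
    mink_comm _ b, h.mink_left_dir₁, h.mink_right_dir₁, zero_smul, zero_sub, smul_neg, neg_neg,
    inv_smul_smul₀ h.shDist_ne_zero]

theorem mcross_left_dir₁ (_ : IsPair a b) : mcross a (dir₁ a b) = normal a b := by
  rw [dir₁, mcross_smul_right, mcross_sub_right, mcross_smul_right, mcross_self, smul_zero,
    sub_zero, normal]

theorem mcross_left_dir₂ (h : IsPair a b) : mcross a (dir₂ a b) = chDist a b • normal a b := by
  rw [h.dir₂_eq, ← h.mcross_left_dir₁, ← mcross_smul_right]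
  ext i
  fin_cases i <;> simp [mcross] <;> ring

theorem mcross_left_normal (h : IsPair a b) : mcross a (normal a b) = -dir₁ a b := by
  rw [← h.mcross_left_dir₁, mcross_mcross_right, h.left, h.mink_left_dir₁]
  simp

end IsPair

theorem chDist_act (g : SO21) (a b : Fin 3 → ℝ) : chDist (act g a) (act g b) = chDist a b := by
  rw [chDist, mink_act, chDist]

theorem shDist_act (g : SO21) (a b : Fin 3 → ℝ) : shDist (act g a) (act g b) = shDist a b := by
  rw [shDist, chDist_act, shDist]

theorem dir₁_act (g : SO21) (a b : Fin 3 → ℝ) : dir₁ (act g a) (act g b) = act g (dir₁ a b) := by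
  rw [dir₁, dir₁, shDist_act, chDist_act, act_smul, act_sub, act_smul]

theorem dir₂_act (g : SO21) (a b : Fin 3 → ℝ) : dir₂ (act g a) (act g b) = act g (dir₂ a b) := by
  rw [dir₂, dir₂, shDist_act, chDist_act, act_smul, act_sub, act_smul]

theorem normal_act (g : SO21) (a b : Fin 3 → ℝ) :
    normal (act g a) (act g b) = act g (normal a b) := by
  rw [normal, normal, shDist_act, mcross_act, act_smul]

/-! ### The Riemannian distance -/

theorem mink_deriv_eq_zero_of_mem_L2 {c : ℝ → Fin 3 → ℝ} (hc : ContDiff ℝ 1 c)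
    (hL : ∀ t ∈ Icc (0 : ℝ) 1, c t ∈ L2) {t : ℝ} (ht : t ∈ Ioo (0 : ℝ) 1) :
    mink (c t) (deriv c t) = 0 := by
  have hd : ∀ i, HasDerivAt (fun t => c t i) (deriv c t i) t :=
    hasDerivAt_pi.1 (hc.differentiable (by simp) t).hasDerivAt
  have h1 := (((hd 0).mul (hd 0)).add ((hd 1).mul (hd 1))).sub ((hd 2).mul (hd 2))
  have h2 : HasDerivAt (fun _ : ℝ => (-1 : ℝ)) 0 t := hasDerivAt_const t _
  have h3 := h2.congr_of_eventuallyEq (f₁ := fun t => c t 0 * c t 0 + c t 1 * c t 1 - c t 2 * c t 2)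
    (Filter.mem_of_superset (Ioo_mem_nhds ht.1 ht.2) fun u hu => by
      have := (hL u (Ioo_subset_Icc_self hu)).1
      rw [mink_eq] at this
      exact this)
  have := h1.unique h3
  rw [mink_eq]
  linarith

theorem continuous_speed {c : ℝ → Fin 3 → ℝ} (hc : ContDiff ℝ 1 c) :
    Continuous fun t => Real.sqrt (mink (deriv c t) (deriv c t)) := by
  have h : Continuous (deriv c) := hc.continuous_deriv le_rfl
  simp only [mink_eq]
  fun_prop

/-- For unit spacelike n the function arsinh⟨n, ·⟩ is 1-Lipschitz on L²: along c its derivative is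
⟨n, c'⟩ / √(1 + ⟨n, c⟩²), bounded by the speed by `mink_sq_le_of_unit`. -/
theorem arsinh_mink_sub_le_curveLength {n : Fin 3 → ℝ} (hn : mink n n = 1) {c : ℝ → Fin 3 → ℝ}
    (hc : ContDiff ℝ 1 c) (hL : ∀ t ∈ Icc (0 : ℝ) 1, c t ∈ L2) :
    Real.arsinh (mink n (c 1)) - Real.arsinh (mink n (c 0)) ≤ curveLength c := by
  have hd : ∀ t i, HasDerivAt (fun t => c t i) (deriv c t i) t := fun t =>
    hasDerivAt_pi.1 (hc.differentiable (by simp) t).hasDerivAt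
  have hm : ∀ t, HasDerivAt (fun t => mink n (c t)) (mink n (deriv c t)) t := by
    intro t
    simp only [mink_eq]
    exact (((hd t 0).const_mul _).add ((hd t 1).const_mul _)).sub ((hd t 2).const_mul _)
  have ha := fun t => (hm t).arsinh
  refine intervalIntegral.sub_le_integral_of_hasDeriv_right_of_le zero_le_one
    (fun t _ => (ha t).continuousAt.continuousWithinAt) (fun t _ => (ha t).hasDerivWithinAt)
    (continuous_speed hc).continuousOn.integrableOn_Icc fun t ht => ?_
  have h1 := mink_sq_le_of_unit (hL t (Ioo_subset_Icc_self ht)) hn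
    (mink_deriv_eq_zero_of_mem_L2 hc hL ht)
  have hp : 0 < Real.sqrt (1 + mink n (c t) ^ 2) := Real.sqrt_pos.2 (by positivity)
  rw [smul_eq_mul, inv_mul_le_iff₀ hp, ← Real.sqrt_mul (by positivity)]
  exact Real.le_sqrt_of_sq_le h1

theorem riemDist_eq {R S : L2} (h : R ≠ S) : riemDist R S = Real.arsinh (shDist R S) := by
  have hp := isPair_of_ne h
  set d := Real.arsinh (shDist R S) with hd
  refine IsLeast.csInf_eq ⟨?_, ?_⟩
  · set e := dir₁ (R : Fin 3 → ℝ) S with he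
    -- The geodesic from R with initial direction e, of constant speed d.
    set c : ℝ → Fin 3 → ℝ := fun t => Real.cosh (t * d) • (R : Fin 3 → ℝ) + Real.sinh (t * d) • e
      with hc
    have hder : ∀ t, HasDerivAt c
        ((Real.sinh (t * d) * d) • (R : Fin 3 → ℝ) + (Real.cosh (t * d) * d) • e) t := by
      intro t
      have hl : HasDerivAt (fun t : ℝ => t * d) d t := by simpa using (hasDerivAt_id t).mul_const d
      exact (hl.cosh.smul_const _).add (hl.sinh.smul_const _)
    have hRe : mink R e = 0 := hp.mink_left_dir₁
    have heR : mink e R = 0 := by rw [mink_comm, hRe]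
    have hee : mink e e = 1 := hp.mink_dir₁_dir₁
    refine ⟨c, ?_, ?_, ?_, ?_, ?_⟩
    · fun_prop
    · intro t _
      have hn : mink (c t) (c t) = -1 := by
        simp only [hc, mink_add_left, mink_add_right, mink_smul_left, mink_smul_right, hRe, heR,
          hee, hp.left]
        linear_combination -Real.cosh_sq (t * d)
      have hcR : mink (c t) R = -Real.cosh (t * d) := by
        simp only [hc, mink_add_left, mink_smul_left, heR, hp.left]
        ring
      refine mem_L2_of_mink_neg hn R.2 ?_
      rw [hcR]
      exact neg_neg_of_pos (Real.cosh_pos _)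
    · simp [hc]
    · simp only [hc, one_mul]
      rw [hd, hp.cosh_arsinh_shDist, Real.sinh_arsinh, add_comm, ← hp.right_eq]
    · have hsp : ∀ t, Real.sqrt (mink (deriv c t) (deriv c t)) = d := by
        intro t
        rw [(hder t).deriv]
        simp only [mink_add_left, mink_add_right, mink_smul_left, mink_smul_right, hRe, heR,
          hee, hp.left]
        refine Eq.trans (congrArg Real.sqrt ?_)
          (Real.sqrt_sq (Real.arsinh_nonneg_iff.2 hp.shDist_pos.le))
        linear_combination d ^ 2 * Real.cosh_sq (t * d)
      simp only [curveLength, hsp]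
      simp
  · rintro l ⟨c, hc, hL, h0, h1, rfl⟩
    -- With n = `dir₁ R S` the 1-Lipschitz function is 0 at R and d at S.
    have := arsinh_mink_sub_le_curveLength hp.mink_dir₁_dir₁ hc hL
    rw [h0, h1, mink_comm _ (S : Fin 3 → ℝ), hp.mink_right_dir₁, mink_comm _ (R : Fin 3 → ℝ),
      hp.mink_left_dir₁, Real.arsinh_zero, sub_zero] at this
    exact this

/-! ### The reduction map -/

/-- The value of the momentum of the body `a` on a tangent vector, in canonical coordinates. -/
def pair (y : Model) (a : Fin 2) (v : Fin 3 → ℝ) : ℝ := y.2 (a, 0) * v 0 + y.2 (a, 1) * v 1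

/-- The position of the body `a`, in canonical coordinates. -/
def pos (y : Model) (a : Fin 2) : Fin 3 → ℝ :=
  ![y.1 (a, 0), y.1 (a, 1), Real.sqrt (1 + y.1 (a, 0) ^ 2 + y.1 (a, 1) ^ 2)]

theorem pos_mem (y : Model) (a : Fin 2) : pos y a ∈ L2 := (lift fun j => y.1 (a, j)).2

theorem pos_coords (z : PhaseSpace) (a : Fin 2) : pos (coords z) a = z.R a :=
  congrArg Subtype.val (L2_ext (R := lift fun j => (coords z).1 (a, j)) (S := z.R a) rfl rfl)

theorem pair_add (y : Model) (a : Fin 2) (u v : Fin 3 → ℝ) :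
    pair y a (u + v) = pair y a u + pair y a v := by
  simp only [pair, Pi.add_apply]; ring

theorem pair_smul (y : Model) (a : Fin 2) (c : ℝ) (v : Fin 3 → ℝ) :
    pair y a (c • v) = c * pair y a v := by
  simp only [pair, Pi.smul_apply, smul_eq_mul]; ring

/-- `pair` extends the covector from the tangent plane to ℝ³ by ignoring the third component. Only
its values on tangent vectors are geometric; other values appear later as chart-dependent terms. -/
theorem covec_eq_pair (z : PhaseSpace) (a : Fin 2) (v : tangentL2 (z.R a)) :
    z.α a v = pair (coords z) a v := by
  conv_lhs => rw [tangent_eq (z.R a) v]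
  simp only [map_add, map_smul, smul_eq_mul, pair, coords]
  ring

/-- The invariants `(m, q, p)` of a pair of points and of linear forms on the tangent spaces. -/
def invariants (a b : Fin 3 → ℝ) (P : Fin 2 → (Fin 3 → ℝ) → ℝ) : E5 :=
  (![P 0 (dir₁ a b) + P 1 (dir₂ a b), P 0 (normal a b) + chDist a b * P 1 (normal a b),
    shDist a b * P 1 (normal a b)], Real.arsinh (shDist a b), P 1 (dir₂ a b))

/-- The reduction map in canonical coordinates. -/
def reductionCoords (y : Model) : E5 := invariants (pos y 0) (pos y 1) (pair y)

/-- The reduction map `T*Q → ℝ³ × (0, ∞) × ℝ`. -/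
def reduction (z : PhaseSpace) : E5 := reductionCoords (coords z)

theorem reduction_eq (z : PhaseSpace) :
    reduction z = invariants (z.R 0) (z.R 1) (pair (coords z)) := by
  rw [reduction, reductionCoords, pos_coords, pos_coords]

theorem PhaseSpace.isPair (z : PhaseSpace) : IsPair (z.R 0 : Fin 3 → ℝ) (z.R 1) :=
  isPair_of_ne z.ne

theorem isPair_pos {y : Model} (hy : y ∈ range coords) : IsPair (pos y 0) (pos y 1) := by
  obtain ⟨z, rfl⟩ := hy
  rw [pos_coords, pos_coords]
  exact z.isPair

theorem reduction_mem (z : PhaseSpace) : reduction z ∈ reducedSet := by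
  rw [reduction_eq]
  exact Real.arsinh_pos_iff.2 z.isPair.shDist_pos

theorem qCoord_reduction (z : PhaseSpace) : qCoord (reduction z) = riemDist (z.R 0) (z.R 1) := by
  rw [reduction_eq, riemDist_eq z.ne]
  rfl

theorem pair_smul_act (g : SO21) (z : PhaseSpace) (a : Fin 2) {v : Fin 3 → ℝ}
    (hv : v ∈ tangentL2 (z.R a)) : pair (coords (g • z)) a (act g v) = pair (coords z) a v := by
  have h1 : act g v ∈ tangentL2 ((g • z).R a) := by
    rw [mem_tangentL2, smul_R, mink_act]
    exact hv
  have h2 : act g⁻¹ (act g v) ∈ tangentL2 (z.R a) := by rwa [act_inv_act]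
  have h3 := smul_α g z a (act g v) h1 h2
  rw [covec_eq_pair, covec_eq_pair] at h3
  simpa only [act_inv_act] using h3

theorem reduction_smul (g : SO21) (z : PhaseSpace) : reduction (g • z) = reduction z := by
  have h := z.isPair
  rw [reduction_eq, reduction_eq, smul_R, smul_R, invariants, invariants, chDist_act, shDist_act,
    dir₁_act, dir₂_act, normal_act, pair_smul_act g z 0 h.mink_left_dir₁,
    pair_smul_act g z 1 h.mink_right_dir₂, pair_smul_act g z 0 h.mink_left_normal,
    pair_smul_act g z 1 h.mink_right_normal]

/-- A section of the reduction map, in canonical coordinates: the first body is at `(0, 0, 1)` and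
the second one at `(sinh q, 0, cosh q)`. -/
def sectionCoords (x : E5) : Model :=
  (fun i => ![![0, 0], ![Real.sinh x.2.1, 0]] i.1 i.2,
    fun i => ![![x.1 0 - x.2.2, x.1 1 - Real.cosh x.2.1 / Real.sinh x.2.1 * x.1 2],
      ![x.2.2 / Real.cosh x.2.1, x.1 2 / Real.sinh x.2.1]] i.1 i.2)

theorem sectionCoords_mem {x : E5} (hx : x ∈ reducedSet) : sectionCoords x ∈ range coords := by
  rw [range_coords]
  intro h
  have := congrFun h 0
  simp [sectionCoords] at this
  exact (Real.sinh_pos_iff.2 hx).ne this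

/-- A section of the reduction map. -/
def reductionSection (x : E5) : PhaseSpace :=
  (isOpenEmbedding_coords.toOpenPartialHomeomorph coords).symm (sectionCoords x)

theorem coords_symm {y : Model} (hy : y ∈ range coords) :
    coords ((isOpenEmbedding_coords.toOpenPartialHomeomorph coords).symm y) = y :=
  (isOpenEmbedding_coords.toOpenPartialHomeomorph coords).right_inv (by simpa using hy)

theorem symm_coords (z : PhaseSpace) :
    (isOpenEmbedding_coords.toOpenPartialHomeomorph coords).symm (coords z) = z :=
  (isOpenEmbedding_coords.toOpenPartialHomeomorph coords).left_inv (by simp)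

theorem coords_reductionSection {x : E5} (hx : x ∈ reducedSet) :
    coords (reductionSection x) = sectionCoords x := coords_symm (sectionCoords_mem hx)

theorem pos_sectionCoords_zero (x : E5) : pos (sectionCoords x) 0 = ![0, 0, 1] := by
  simp [pos, sectionCoords]

theorem pos_sectionCoords_one (x : E5) :
    pos (sectionCoords x) 1 = ![Real.sinh x.2.1, 0, Real.cosh x.2.1] := by
  have h : 1 + Real.sinh x.2.1 ^ 2 = Real.cosh x.2.1 ^ 2 := by rw [Real.cosh_sq]; ring
  simp [pos, sectionCoords, h, Real.sqrt_sq (Real.cosh_pos _).le]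

theorem reduction_reductionSection {x : E5} (hx : x ∈ reducedSet) :
    reduction (reductionSection x) = x := by
  have hs : 0 < Real.sinh x.2.1 := Real.sinh_pos_iff.2 hx
  have hc := Real.cosh_pos x.2.1
  have hcs := Real.cosh_sq x.2.1
  have h1 : chDist (pos (sectionCoords x) 0) (pos (sectionCoords x) 1) = Real.cosh x.2.1 := by
    rw [pos_sectionCoords_zero, pos_sectionCoords_one, chDist, mink_eq]
    simp
  have h2 : shDist (pos (sectionCoords x) 0) (pos (sectionCoords x) 1) = Real.sinh x.2.1 := by
    rw [shDist, h1, hcs, add_sub_cancel_right, Real.sqrt_sq hs.le]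
  rw [reduction, coords_reductionSection hx, reductionCoords, invariants, dir₁, dir₂, normal, h1,
    h2, pos_sectionCoords_zero, pos_sectionCoords_one, Real.arsinh_sinh]
  simp only [pair, sectionCoords, mcross]
  refine Prod.ext (funext fun i => ?_) (Prod.ext rfl ?_)
  · fin_cases i <;> simp <;> field_simp <;> ring
  · simp
    field_simp

/-- The matrix with columns `dir₁ a b`, `normal a b`, a. For the standard pair of `sectionCoords`
with q > 0 this frame is the standard basis, so the matrix carries that pair to (a, b) when the
distances agree. -/
theorem exists_frame {a b : Fin 3 → ℝ} (h : IsPair a b) (ha : a ∈ L2) :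
    ∃ g : SO21, ∀ v, act g v = v 0 • dir₁ a b + v 1 • normal a b + v 2 • a := by
  have h11 := h.mink_dir₁_dir₁
  have h12 := h.mink_dir₁_normal
  have h22 := h.mink_normal_normal
  have h31 := h.mink_left_dir₁
  have h32 := h.mink_left_normal
  have h33 := h.left
  have hdet : (Matrix.of ![dir₁ a b, normal a b, a])ᵀ.det = 1 := by
    rw [Matrix.det_transpose, ← mink_mcross_eq_det, mcross_anticomm, h.mcross_normal_dir₁,
      ← neg_one_smul ℝ, mink_smul_left, h33]
    norm_num
  generalize dir₁ a b = e at *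
  generalize normal a b = n at *
  have hv : ∀ v, (Matrix.of ![e, n, a])ᵀ *ᵥ v = v 0 • e + v 1 • n + v 2 • a := by
    intro v
    ext i
    simp [Matrix.mulVec, dotProduct, Fin.sum_univ_three]
    ring
  have hK : (Matrix.of ![e, n, a])ᵀᵀ * K * (Matrix.of ![e, n, a])ᵀ = K := by
    rw [mink_eq] at *
    ext i j
    rw [Matrix.mul_apply]
    simp only [K, Matrix.mul_diagonal, Fin.sum_univ_three]
    fin_cases i <;> fin_cases j <;> simp <;> linarith
  refine ⟨⟨⟨(Matrix.of ![e, n, a])ᵀ, hdet⟩, hK, fun R hR => ?_⟩, hv⟩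
  -- The upper sheet is preserved because (0, 0, 1) goes to a, so the image of R has product -R 2 <
  -- 0 with a.
  have hm : ∀ v, mink ((Matrix.of ![e, n, a])ᵀ *ᵥ R) ((Matrix.of ![e, n, a])ᵀ *ᵥ v) = mink R v := by
    intro v
    rw [mink_mulVec, hK, mink]
  refine mem_L2_of_mink_neg (b := a) ((hm R).trans hR.1) ha ?_
  have h3 : a = (Matrix.of ![e, n, a])ᵀ *ᵥ ![0, 0, 1] := by
    rw [hv]
    simp
  have h4 := hm ![0, 0, 1]
  rw [← h3] at h4
  rw [h4, mink_eq]
  simpa using hR.2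

theorem exists_smul_reductionSection (z : PhaseSpace) :
    ∃ g : SO21, g • reductionSection (reduction z) = z := by
  have h := z.isPair
  obtain ⟨g, hg⟩ := exists_frame h (z.R 0).2
  refine ⟨g, ?_⟩
  have hx := reduction_mem z
  have hcs := coords_reductionSection hx
  have hsh : Real.sinh (reduction z).2.1 = shDist (z.R 0 : Fin 3 → ℝ) (z.R 1) := by
    rw [reduction_eq]
    exact Real.sinh_arsinh _
  have hch : Real.cosh (reduction z).2.1 = chDist (z.R 0 : Fin 3 → ℝ) (z.R 1) := by
    rw [reduction_eq]
    exact h.cosh_arsinh_shDist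
  have hs := h.shDist_ne_zero
  have hc : chDist (z.R 0 : Fin 3 → ℝ) (z.R 1) ≠ 0 := by linarith [h.one_lt]
  have hR0 : ((reductionSection (reduction z)).R 0 : Fin 3 → ℝ) = ![0, 0, 1] := by
    rw [← pos_coords, hcs, pos_sectionCoords_zero]
  have hR1 : ((reductionSection (reduction z)).R 1 : Fin 3 → ℝ) =
      ![shDist (z.R 0 : Fin 3 → ℝ) (z.R 1), 0, chDist (z.R 0 : Fin 3 → ℝ) (z.R 1)] := by
    rw [← pos_coords, hcs, pos_sectionCoords_one, hsh, hch]
  have hR : ∀ a, ((g • reductionSection (reduction z)).R a : Fin 3 → ℝ) = z.R a := by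
    intro a
    rw [smul_R]
    fin_cases a
    · change act g ((reductionSection (reduction z)).R 0 : Fin 3 → ℝ) = z.R 0
      rw [hR0, hg]
      simp
    · change act g ((reductionSection (reduction z)).R 1 : Fin 3 → ℝ) = z.R 1
      rw [hR1, hg]
      simpa using h.right_eq.symm
  refine PhaseSpace.ext_covec hR fun a v hv hw => ?_
  rw [covec_eq_pair, covec_eq_pair]
  change pair _ a v = pair _ a v
  obtain ⟨u, rfl⟩ : ∃ u, v = act g u := ⟨act g⁻¹ v, (act_act_inv g v).symm⟩
  have hu : u ∈ tangentL2 ((reductionSection (reduction z)).R a) := by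
    rw [mem_tangentL2, smul_R, mink_act] at hv
    exact hv
  rw [pair_smul_act g _ a hu, hcs, hg]
  rw [mem_tangentL2] at hu
  have e1 : (reduction z).1 0 - (reduction z).2.2 =
      pair (coords z) 0 (dir₁ (z.R 0 : Fin 3 → ℝ) (z.R 1)) := by
    rw [reduction_eq]
    simp [invariants]
  have e2 : (reduction z).1 1 = pair (coords z) 0 (normal (z.R 0 : Fin 3 → ℝ) (z.R 1)) +
      chDist (z.R 0 : Fin 3 → ℝ) (z.R 1) *
        pair (coords z) 1 (normal (z.R 0 : Fin 3 → ℝ) (z.R 1)) := by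
    rw [reduction_eq]
    rfl
  have e3 : (reduction z).1 2 = shDist (z.R 0 : Fin 3 → ℝ) (z.R 1) *
      pair (coords z) 1 (normal (z.R 0 : Fin 3 → ℝ) (z.R 1)) := by
    rw [reduction_eq]
    rfl
  -- The vector `dir₂` is written through `dir₁` and the first position, the vectors in which the
  -- image under g is expanded.
  have e4 : (reduction z).2.2 = chDist (z.R 0 : Fin 3 → ℝ) (z.R 1) *
      pair (coords z) 1 (dir₁ (z.R 0 : Fin 3 → ℝ) (z.R 1)) +
      shDist (z.R 0 : Fin 3 → ℝ) (z.R 1) * pair (coords z) 1 (z.R 0 : Fin 3 → ℝ) := by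
    rw [← pair_smul, ← pair_smul, ← pair_add, ← h.dir₂_eq, reduction_eq]
    rfl
  fin_cases a
  · change mink ((reductionSection (reduction z)).R 0) u = 0 at hu
    rw [hR0, mink_eq] at hu
    have hu2 : u 2 = 0 := by simpa using hu
    change pair _ 0 _ = pair _ 0 _
    rw [hu2, pair_add, pair_add, pair_smul, pair_smul, pair_smul]
    conv_lhs => rw [pair]
    simp only [sectionCoords, Matrix.cons_val_zero, Matrix.cons_val_one]
    rw [e1, e2, e3, hsh, hch]
    field_simp
    ring
  · change mink ((reductionSection (reduction z)).R 1) u = 0 at hu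
    rw [hR1, mink_eq] at hu
    -- Tangency at (sinh q, 0, cosh q) fixes u 2; this matches the factor 1 / cosh q in the section,
    -- where `dir₂` is cosh q times ∂/∂X.
    have hu2 : chDist (z.R 0 : Fin 3 → ℝ) (z.R 1) * u 2 =
        shDist (z.R 0 : Fin 3 → ℝ) (z.R 1) * u 0 := by
      simp at hu
      linarith
    change pair _ 1 _ = pair _ 1 _
    rw [pair_add, pair_add, pair_smul, pair_smul, pair_smul]
    conv_lhs => rw [pair]
    simp only [sectionCoords, Matrix.cons_val_zero, Matrix.cons_val_one]
    rw [e3, e4, hsh, hch]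
    field_simp
    linear_combination -pair (coords z) 1 (z.R 0 : Fin 3 → ℝ) * hu2

/-! ### Smoothness -/

theorem contDiff_pos (a : Fin 2) : ContDiff ℝ ∞ fun y : Model => pos y a := by
  rw [contDiff_pi]
  intro i
  fin_cases i
  · change ContDiff ℝ ∞ fun y : Model => y.1 (a, 0)
    fun_prop
  · change ContDiff ℝ ∞ fun y : Model => y.1 (a, 1)
    fun_prop
  · change ContDiff ℝ ∞ fun y : Model => Real.sqrt (1 + y.1 (a, 0) ^ 2 + y.1 (a, 1) ^ 2)
    exact ContDiff.sqrt (by fun_prop) fun y => by positivity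

theorem contDiff_chDist : ContDiff ℝ ∞ fun y : Model => chDist (pos y 0) (pos y 1) := by
  have h0 := contDiff_pi.1 (contDiff_pos 0)
  have h1 := contDiff_pi.1 (contDiff_pos 1)
  simp only [chDist, mink_eq]
  fun_prop

theorem contDiffAt_shDist {y : Model} (hy : y ∈ range coords) :
    ContDiffAt ℝ ∞ (fun y : Model => shDist (pos y 0) (pos y 1)) y := by
  refine ContDiffAt.sqrt ((contDiff_chDist.contDiffAt.pow 2).sub contDiffAt_const) ?_
  rw [← (isPair_pos hy).shDist_sq]
  exact pow_ne_zero 2 (isPair_pos hy).shDist_ne_zero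

theorem contDiffAt_dir₁ {y : Model} (hy : y ∈ range coords) :
    ContDiffAt ℝ ∞ (fun y : Model => dir₁ (pos y 0) (pos y 1)) y :=
  ((contDiffAt_shDist hy).inv (isPair_pos hy).shDist_ne_zero).smul
    ((contDiff_pos 1).contDiffAt.sub (contDiff_chDist.contDiffAt.smul (contDiff_pos 0).contDiffAt))

theorem contDiffAt_dir₂ {y : Model} (hy : y ∈ range coords) :
    ContDiffAt ℝ ∞ (fun y : Model => dir₂ (pos y 0) (pos y 1)) y :=
  ((contDiffAt_shDist hy).inv (isPair_pos hy).shDist_ne_zero).smul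
    ((contDiff_chDist.contDiffAt.smul (contDiff_pos 1).contDiffAt).sub (contDiff_pos 0).contDiffAt)

theorem contDiffAt_normal {y : Model} (hy : y ∈ range coords) :
    ContDiffAt ℝ ∞ (fun y : Model => normal (pos y 0) (pos y 1)) y := by
  refine ((contDiffAt_shDist hy).inv (isPair_pos hy).shDist_ne_zero).smul
    (ContDiff.contDiffAt (contDiff_pi.2 fun i => ?_))
  have h0 := contDiff_pi.1 (contDiff_pos 0)
  have h1 := contDiff_pi.1 (contDiff_pos 1)
  fin_cases i <;> simp only [mcross] <;> simp <;> fun_prop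

theorem contDiffAt_pair {y : Model} {F : Model → Fin 3 → ℝ} (hF : ContDiffAt ℝ ∞ F y)
    (a : Fin 2) :
    ContDiffAt ℝ ∞ (fun y : Model => pair y a (F y)) y := by
  have h := contDiffAt_pi.1 hF
  simp only [pair]
  fun_prop

theorem contDiffAt_reductionCoords {y : Model} (hy : y ∈ range coords) :
    ContDiffAt ℝ ∞ reductionCoords y := by
  have h1 := contDiffAt_dir₁ hy
  have h2 := contDiffAt_dir₂ hy
  have hn := contDiffAt_normal hy
  have hs := contDiffAt_shDist hy
  refine ContDiffAt.prodMk (contDiffAt_pi.2 fun i => ?_) (ContDiffAt.prodMk ?_ ?_)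
  · fin_cases i
    · exact (contDiffAt_pair h1 0).add (contDiffAt_pair h2 1)
    · exact (contDiffAt_pair hn 0).add (contDiff_chDist.contDiffAt.mul (contDiffAt_pair hn 1))
    · exact hs.mul (contDiffAt_pair hn 1)
  · exact hs.arsinh
  · exact contDiffAt_pair h2 1

theorem contDiffAt_sectionCoords {x : E5} (hx : x ∈ reducedSet) :
    ContDiffAt ℝ ∞ sectionCoords x := by
  have hs : Real.sinh x.2.1 ≠ 0 := (Real.sinh_pos_iff.2 hx).ne'
  have hc : Real.cosh x.2.1 ≠ 0 := (Real.cosh_pos _).ne'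
  refine ContDiffAt.prodMk (contDiffAt_pi.2 fun i => ?_) (contDiffAt_pi.2 fun i => ?_)
  · obtain ⟨a, j⟩ := i
    fin_cases a <;> fin_cases j <;> simp <;> fun_prop
  · obtain ⟨a, j⟩ := i
    fin_cases a <;> fin_cases j <;> simp <;> fun_prop (disch := assumption)

/-! ### The reduction map is Poisson -/

/-- The derivatives at time `0` of the frame of a moving pair of points. -/
structure HasFrameDeriv (r₀ r₁ : ℝ → Fin 3 → ℝ) (c' s' : ℝ) (d₁ d₂ n' : Fin 3 → ℝ) : Prop where
  ch : HasDerivAt (fun t => chDist (r₀ t) (r₁ t)) c' 0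
  sh : HasDerivAt (fun t => shDist (r₀ t) (r₁ t)) s' 0
  dir₁ : HasDerivAt (fun t => dir₁ (r₀ t) (r₁ t)) d₁ 0
  dir₂ : HasDerivAt (fun t => dir₂ (r₀ t) (r₁ t)) d₂ 0
  normal : HasDerivAt (fun t => normal (r₀ t) (r₁ t)) n' 0

/-- The hypotheses are the derivatives of s² = c² - 1, s `dir₁` = b - c a, s `dir₂` = c b - a and s
`normal` = `mcross a b`, with s = `shDist` and c = `chDist`. Candidates for the derivatives can thus
be verified without division. -/
theorem hasFrameDeriv {r₀ r₁ : ℝ → Fin 3 → ℝ} {a b v₀ v₁ d₁ d₂ n' : Fin 3 → ℝ} {c' s' : ℝ}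
    (h₀ : HasDerivAt r₀ v₀ 0) (h₁ : HasDerivAt r₁ v₁ 0) (ha : r₀ 0 = a) (hb : r₁ 0 = b)
    (h : IsPair a b) (hc : c' = -(mink v₀ b + mink a v₁))
    (hs : shDist a b * s' = chDist a b * c')
    (hd₁ : shDist a b • d₁ + s' • dir₁ a b = v₁ - (c' • a + chDist a b • v₀))
    (hd₂ : shDist a b • d₂ + s' • dir₂ a b = c' • b + chDist a b • v₁ - v₀)
    (hn : shDist a b • n' + s' • normal a b = mcross v₀ b + mcross a v₁) :
    HasFrameDeriv r₀ r₁ c' s' d₁ d₂ n' := by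
  subst ha hb
  have hne := h.shDist_ne_zero
  have h₀' := hasDerivAt_pi.1 h₀
  have h₁' := hasDerivAt_pi.1 h₁
  have Hc : HasDerivAt (fun t => chDist (r₀ t) (r₁ t)) c' 0 := by
    have h2 := (((h₀' 0).mul (h₁' 0)).add ((h₀' 1).mul (h₁' 1))).sub ((h₀' 2).mul (h₁' 2))
    simp only [chDist, mink_eq]
    refine h2.neg.congr_deriv ?_
    rw [hc, mink_eq, mink_eq]
    ring
  have Hs : HasDerivAt (fun t => shDist (r₀ t) (r₁ t)) s' 0 := by
    have h2 := ((Hc.pow 2).sub_const 1).sqrt (by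
      simp only [Pi.pow_apply]
      rw [← h.shDist_sq]
      exact pow_ne_zero 2 hne)
    refine h2.congr_deriv ?_
    change _ / (2 * shDist (r₀ 0) (r₁ 0)) = s'
    rw [div_eq_iff (by simpa using hne)]
    simp
    linear_combination -2 * hs
  have Hi := Hs.inv hne
  have key : ∀ {F : ℝ → Fin 3 → ℝ} {F' G : Fin 3 → ℝ}, HasDerivAt F F' 0 →
      shDist (r₀ 0) (r₁ 0) • G + s' • ((shDist (r₀ 0) (r₁ 0))⁻¹ • F 0) = F' →
      HasDerivAt (fun t => (shDist (r₀ t) (r₁ t))⁻¹ • F t) G 0 := by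
    intro F F' G hF hG
    refine (Hi.smul hF).congr_deriv ?_
    rw [← hG]
    ext i
    simp
    field_simp
    ring
  refine ⟨Hc, Hs, key (h₁.sub (Hc.smul h₀)) (hd₁.trans ?_), key ((Hc.smul h₁).sub h₀)
    (hd₂.trans ?_), key (F' := mcross v₀ (r₁ 0) + mcross (r₀ 0) v₁) (hasDerivAt_pi.2 fun i => ?_) hn⟩
  · simp only [add_comm]
  · simp only [add_comm]
  · have g01 := ((h₀' 0).mul (h₁' 1)).sub ((h₀' 1).mul (h₁' 0))
    have g12 := ((h₀' 1).mul (h₁' 2)).sub ((h₀' 2).mul (h₁' 1))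
    have g20 := ((h₀' 2).mul (h₁' 0)).sub ((h₀' 0).mul (h₁' 2))
    fin_cases i
    · refine g12.congr_deriv ?_
      simp [mcross]
      ring
    · refine g20.congr_deriv ?_
      simp [mcross]
      ring
    · refine g01.neg.congr_deriv ?_
      simp [mcross]
      ring

/-- The direction in the space of canonical coordinates that is given by a pair of velocities. -/
def posDir (v₀ v₁ : Fin 3 → ℝ) : Model := (fun i => ![v₀, v₁] i.1 i.2.castSucc, 0)

/-- A straight line in the chart is not straight in ℝ³; tangency of v is what makes the derivative
of the square root equal to the third component of v. -/
theorem hasDerivAt_pos (y : Model) (v : Fin 2 → Fin 3 → ℝ) (a : Fin 2)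
    (hv : mink (pos y a) (v a) = 0) :
    HasDerivAt (fun t : ℝ => pos (y + t • posDir (v 0) (v 1)) a) (v a) 0 := by
  have e : ∀ j, (posDir (v 0) (v 1)).1 (a, j) = v a j.castSucc := by
    intro j
    fin_cases a <;> rfl
  have hl : ∀ j, HasDerivAt (fun t : ℝ => (y + t • posDir (v 0) (v 1)).1 (a, j))
      (v a j.castSucc) 0 := by
    intro j
    have h := ((hasDerivAt_id (0 : ℝ)).mul_const (v a j.castSucc)).const_add (y.1 (a, j))
    simpa [e] using h
  have h2 : HasDerivAt (fun t : ℝ => Real.sqrt (1 + (y + t • posDir (v 0) (v 1)).1 (a, 0) ^ 2 +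
      (y + t • posDir (v 0) (v 1)).1 (a, 1) ^ 2)) (v a 2) 0 := by
    have hp := (pos_mem y a).2
    have hp' : pos y a 2 = Real.sqrt (1 + y.1 (a, 0) ^ 2 + y.1 (a, 1) ^ 2) := rfl
    have h3 := ((((hl 0).pow 2).const_add 1).add ((hl 1).pow 2)).sqrt (by
      simp
      positivity)
    refine h3.congr_deriv ?_
    rw [mink_eq] at hv
    simp
    rw [← hp', div_eq_iff (by positivity)]
    simp [pos] at hv ⊢
    linarith
  refine hasDerivAt_pi.2 fun i => ?_
  fin_cases i
  · exact hl 0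
  · exact hl 1
  · exact h2

theorem differentiableAt_reductionCoords {y : Model} (hy : y ∈ range coords) :
    DifferentiableAt ℝ reductionCoords y :=
  (contDiffAt_reductionCoords hy).differentiableAt (by simp)

theorem pair_add_posDir (y : Model) (t : ℝ) (v₀ v₁ : Fin 3 → ℝ) (a : Fin 2) (u : Fin 3 → ℝ) :
    pair (y + t • posDir v₀ v₁) a u = pair y a u := by
  simp [pair, posDir]

theorem hasDerivAt_pair (y : Model) (a : Fin 2) {F : ℝ → Fin 3 → ℝ} {F' : Fin 3 → ℝ} {t : ℝ}
    (hF : HasDerivAt F F' t) : HasDerivAt (fun t => pair y a (F t)) (pair y a F') t :=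
  ((hasDerivAt_pi.1 hF 0).const_mul _).add ((hasDerivAt_pi.1 hF 1).const_mul _)

/-- The derivative of the reduction map in the direction of a pair of velocities. -/
theorem fderiv_reductionCoords_posDir {y : Model} (hy : y ∈ range coords)
    {v₀ v₁ d₁ d₂ n' : Fin 3 → ℝ} {c' s' : ℝ} (hv₀ : mink (pos y 0) v₀ = 0)
    (hv₁ : mink (pos y 1) v₁ = 0) (hc : c' = -(mink v₀ (pos y 1) + mink (pos y 0) v₁))
    (hs : shDist (pos y 0) (pos y 1) * s' = chDist (pos y 0) (pos y 1) * c')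
    (hd₁ : shDist (pos y 0) (pos y 1) • d₁ + s' • dir₁ (pos y 0) (pos y 1) =
      v₁ - (c' • pos y 0 + chDist (pos y 0) (pos y 1) • v₀))
    (hd₂ : shDist (pos y 0) (pos y 1) • d₂ + s' • dir₂ (pos y 0) (pos y 1) =
      c' • pos y 1 + chDist (pos y 0) (pos y 1) • v₁ - v₀)
    (hn : shDist (pos y 0) (pos y 1) • n' + s' • normal (pos y 0) (pos y 1) =
      mcross v₀ (pos y 1) + mcross (pos y 0) v₁) :
    fderiv ℝ reductionCoords y (posDir v₀ v₁) =
      (![pair y 0 d₁ + pair y 1 d₂,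
        pair y 0 n' + (c' * pair y 1 (normal (pos y 0) (pos y 1)) +
          chDist (pos y 0) (pos y 1) * pair y 1 n'),
        s' * pair y 1 (normal (pos y 0) (pos y 1)) + shDist (pos y 0) (pos y 1) * pair y 1 n'],
        s' / chDist (pos y 0) (pos y 1), pair y 1 d₂) := by
  have h := isPair_pos hy
  have hl : HasDerivAt (fun t : ℝ => y + t • posDir v₀ v₁) (posDir v₀ v₁) 0 := by
    simpa using ((hasDerivAt_id (0 : ℝ)).smul_const (posDir v₀ v₁)).const_add y
  have e0 : y + (0 : ℝ) • posDir v₀ v₁ = y := by simp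
  have hF := hasFrameDeriv (hasDerivAt_pos y ![v₀, v₁] 0 hv₀) (hasDerivAt_pos y ![v₀, v₁] 1 hv₁)
    (a := pos y 0) (b := pos y 1) (by simp) (by simp) h hc hs hd₁ hd₂ hn
  have h1 : HasDerivAt (fun t : ℝ => reductionCoords (y + t • posDir v₀ v₁))
      (fderiv ℝ reductionCoords y (posDir v₀ v₁)) 0 := by
    have hd := (differentiableAt_reductionCoords hy).hasFDerivAt
    rw [← e0] at hd
    have := hd.comp_hasDerivAt (0 : ℝ) hl
    rwa [e0] at this
  refine h1.unique ?_
  simp only [reductionCoords, invariants, pair_add_posDir]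
  have hch := hF.ch
  have hsh := hF.sh
  have hp1 := hasDerivAt_pair y 1 hF.dir₂
  have hp2 := hasDerivAt_pair y 1 hF.normal
  simp only [Matrix.cons_val_zero, Matrix.cons_val_one] at hch hsh hp1 hp2
  refine HasDerivAt.prodMk (hasDerivAt_pi.2 fun i => ?_) (HasDerivAt.prodMk ?_ hp1)
  · fin_cases i
    · exact (hasDerivAt_pair y 0 hF.dir₁).add hp1
    · refine ((hasDerivAt_pair y 0 hF.normal).add (hch.mul hp2)).congr_deriv ?_
      rw [e0]
      rfl
    · refine (hsh.mul hp2).congr_deriv ?_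
      rw [e0]
      rfl
  · refine hsh.arsinh.congr_deriv ?_
    rw [e0, h.shDist_sq, add_sub_cancel, Real.sqrt_sq (by linarith [h.one_lt]), smul_eq_mul,
      inv_mul_eq_div]

/-! ### Derivatives of the reduction map along the four velocity fields -/

section directions

variable {y : Model}

/-- Translation along the geodesic: the frame moves by δ`dir₁` = a, δ`dir₂` = b, δ`normal` = 0. In
this and the next three lemmas the canonical momenta ξ stay fixed rather than being transported, so
J need not be constant along the Killing fields. -/
theorem fderiv_reductionCoords_mx (hy : y ∈ range coords) :
    fderiv ℝ reductionCoords y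
        (posDir (dir₁ (pos y 0) (pos y 1)) (dir₂ (pos y 0) (pos y 1))) =
      (![pair y 0 (pos y 0) + pair y 1 (pos y 1), 0, 0], 0, pair y 1 (pos y 1)) := by
  have h := isPair_pos hy
  refine (fderiv_reductionCoords_posDir hy (c' := 0) (s' := 0) (d₁ := pos y 0) (d₂ := pos y 1)
    (n' := 0) h.mink_left_dir₁ h.mink_right_dir₂ ?_ (by simp) ?_ ?_ ?_).trans ?_
  · rw [mink_comm, h.mink_right_dir₁, h.mink_left_dir₂]; ring
  · rw [h.dir₂_eq]; module
  · rw [h.dir₂_eq]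
    have h1 := h.shDist_sq
    ext i
    have h2 := congrFun h.right_eq i
    simp at h2 ⊢
    linear_combination shDist (pos y 0) (pos y 1) * h2 + dir₁ (pos y 0) (pos y 1) i * h1
  · rw [h.mcross_left_dir₂, mcross_anticomm, dir₁, mcross_smul_right, mcross_sub_right,
      mcross_smul_right, mcross_self, mcross_anticomm (pos y 1), normal]
    module
  · simp [pair]

/-- Boost in the plane of a and `normal`, which fixes `dir₁`: δa = `normal`, δ`normal` = a. The
other velocities follow from b = s `dir₁` + c a and `dir₂` = c `dir₁` + s a. -/
theorem fderiv_reductionCoords_my (hy : y ∈ range coords) :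
    fderiv ℝ reductionCoords y (posDir (normal (pos y 0) (pos y 1))
        (chDist (pos y 0) (pos y 1) • normal (pos y 0) (pos y 1))) =
      (![shDist (pos y 0) (pos y 1) * pair y 1 (normal (pos y 0) (pos y 1)),
        pair y 0 (pos y 0) + chDist (pos y 0) (pos y 1) * pair y 1 (pos y 0),
        shDist (pos y 0) (pos y 1) * pair y 1 (pos y 0)], 0,
        shDist (pos y 0) (pos y 1) * pair y 1 (normal (pos y 0) (pos y 1))) := by
  have h := isPair_pos hy
  have hR : mcross (normal (pos y 0) (pos y 1)) (pos y 1) =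
      shDist (pos y 0) (pos y 1) • pos y 0 +
        chDist (pos y 0) (pos y 1) • dir₁ (pos y 0) (pos y 1) := by
    conv_lhs => rw [mcross_anticomm, normal, mcross_smul_right, mcross_mcross_right,
      h.mink_right_left, h.right]
    rw [dir₁]
    have := h.shDist_sq
    have hne := h.shDist_ne_zero
    ext i
    simp
    field_simp
    linear_combination -pos y 0 i * this
  refine (fderiv_reductionCoords_posDir hy (c' := 0) (s' := 0) (d₁ := 0)
    (d₂ := shDist (pos y 0) (pos y 1) • normal (pos y 0) (pos y 1))
    (n' := pos y 0) h.mink_left_normal ?_ ?_ (by simp) ?_ ?_ ?_).trans ?_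
  · rw [mink_smul_right, h.mink_right_normal, mul_zero]
  · rw [mink_smul_right, mink_comm, h.mink_right_normal, h.mink_left_normal]; ring
  · module
  · have := h.shDist_sq
    ext i
    simp
    linear_combination normal (pos y 0) (pos y 1) i * this
  · rw [hR, mcross_smul_right, h.mcross_left_normal]
    module
  · simp only [pair_smul]
    simp [pair]

/-- Rotation about a: δ`dir₁` = `normal`, δ`normal` = -`dir₁`, hence δb = s `normal` and δ`dir₂` = c
`normal`. -/
theorem fderiv_reductionCoords_mz (hy : y ∈ range coords) :
    fderiv ℝ reductionCoords y (posDir 0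
        (shDist (pos y 0) (pos y 1) • normal (pos y 0) (pos y 1))) =
      (![pair y 0 (normal (pos y 0) (pos y 1)) +
          chDist (pos y 0) (pos y 1) * pair y 1 (normal (pos y 0) (pos y 1)),
        -pair y 0 (dir₁ (pos y 0) (pos y 1)) -
          chDist (pos y 0) (pos y 1) * pair y 1 (dir₁ (pos y 0) (pos y 1)),
        -(shDist (pos y 0) (pos y 1) * pair y 1 (dir₁ (pos y 0) (pos y 1)))], 0,
        chDist (pos y 0) (pos y 1) * pair y 1 (normal (pos y 0) (pos y 1))) := by
  have h := isPair_pos hy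
  refine (fderiv_reductionCoords_posDir hy (c' := 0) (s' := 0)
    (d₁ := normal (pos y 0) (pos y 1))
    (d₂ := chDist (pos y 0) (pos y 1) • normal (pos y 0) (pos y 1))
    (n' := (-1 : ℝ) • dir₁ (pos y 0) (pos y 1)) ?_ ?_ ?_ (by simp) ?_ ?_ ?_).trans ?_
  · simp [mink_eq]
  · rw [mink_smul_right, h.mink_right_normal, mul_zero]
  · rw [mink_smul_right, h.mink_left_normal]; simp [mink_eq]
  · module
  · module
  · rw [mcross_smul_right, h.mcross_left_normal, ← zero_smul ℝ (pos y 1), mcross_smul_left]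
    module
  · simp only [pair_smul]
    refine Prod.ext (funext fun i => ?_) (Prod.ext ?_ ?_)
    · fin_cases i
      · simp
      · simp
        ring
      · simp
    · simp
    · simp

/-- Only the second body moves, along the geodesic at unit speed. The frame at a does not change,
δ`dir₂` = b, and q grows at rate 1. -/
theorem fderiv_reductionCoords_p (hy : y ∈ range coords) :
    fderiv ℝ reductionCoords y (posDir 0 (dir₂ (pos y 0) (pos y 1))) =
      (![pair y 1 (pos y 1),
        shDist (pos y 0) (pos y 1) * pair y 1 (normal (pos y 0) (pos y 1)),
        chDist (pos y 0) (pos y 1) * pair y 1 (normal (pos y 0) (pos y 1))], 1,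
        pair y 1 (pos y 1)) := by
  have h := isPair_pos hy
  have hc : chDist (pos y 0) (pos y 1) ≠ 0 := by linarith [h.one_lt]
  refine (fderiv_reductionCoords_posDir hy (c' := shDist (pos y 0) (pos y 1))
    (s' := chDist (pos y 0) (pos y 1)) (d₁ := 0) (d₂ := pos y 1) (n' := 0)
    ?_ h.mink_right_dir₂ ?_ (by ring) ?_ ?_ ?_).trans ?_
  · simp [mink_eq]
  · rw [h.mink_left_dir₂]; simp [mink_eq]
  · rw [h.dir₂_eq]; module
  · module
  · rw [h.mcross_left_dir₂, ← zero_smul ℝ (pos y 1), mcross_smul_left]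
    module
  · simp [pair, hc]

end directions

/-- The derivative of the reduction map in the direction of the momenta. -/
theorem fderiv_reductionCoords_mom {y : Model} (hy : y ∈ range coords) (ξ : Fin 2 × Fin 2 → ℝ) :
    fderiv ℝ reductionCoords y (0, ξ) =
      (![pair (0, ξ) 0 (dir₁ (pos y 0) (pos y 1)) + pair (0, ξ) 1 (dir₂ (pos y 0) (pos y 1)),
        pair (0, ξ) 0 (normal (pos y 0) (pos y 1)) +
          chDist (pos y 0) (pos y 1) * pair (0, ξ) 1 (normal (pos y 0) (pos y 1)),
        shDist (pos y 0) (pos y 1) * pair (0, ξ) 1 (normal (pos y 0) (pos y 1))], 0,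
        pair (0, ξ) 1 (dir₂ (pos y 0) (pos y 1))) := by
  set η : Model := (0, ξ) with hη
  have hl : HasDerivAt (fun t : ℝ => y + t • η) η 0 := by
    simpa using ((hasDerivAt_id (0 : ℝ)).smul_const η).const_add y
  have e0 : y + (0 : ℝ) • η = y := by simp
  have h1 : HasDerivAt (fun t : ℝ => reductionCoords (y + t • η))
      (fderiv ℝ reductionCoords y η) 0 := by
    have hd := (differentiableAt_reductionCoords hy).hasFDerivAt
    rw [← e0] at hd
    have := hd.comp_hasDerivAt (0 : ℝ) hl
    rwa [e0] at this
  refine h1.unique ?_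
  -- The positions, and hence the frame, stay fixed, so J is affine in t.
  have hpos : ∀ (t : ℝ) a, pos (y + t • η) a = pos y a := by
    intro t a
    simp [pos, hη]
  have hpair : ∀ (t : ℝ) a u, pair (y + t • η) a u = pair y a u + t * pair η a u := by
    intro t a u
    simp only [pair, Prod.snd_add, Prod.smul_snd, Pi.add_apply, Pi.smul_apply, smul_eq_mul]
    ring
  have hp : ∀ a u, HasDerivAt (fun t : ℝ => pair y a u + t * pair η a u) (pair η a u) 0 := by
    intro a u
    simpa using ((hasDerivAt_id (0 : ℝ)).mul_const (pair η a u)).const_add (pair y a u)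
  simp only [reductionCoords, invariants, hpos, hpair]
  refine HasDerivAt.prodMk (hasDerivAt_pi.2 fun k => ?_)
    (HasDerivAt.prodMk (hasDerivAt_const _ _) (hp 1 _))
  fin_cases k
  · exact (hp 0 _).add (hp 1 _)
  · exact (hp 0 _).add ((hp 1 _).const_mul _)
  · exact (hp 1 _).const_mul _

/-! ### Momentum gradients and the bracket of pulled-back functions -/

theorem pair_single_add (i : Fin 2 × Fin 2) (u v : Fin 3 → ℝ) :
    pair (0, Pi.single i 1) 0 u + pair (0, Pi.single i 1) 1 v = (posDir u v).1 i := by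
  obtain ⟨a, j⟩ := i
  fin_cases a <;> fin_cases j <;> simp [pair, posDir]

theorem pair_single (i : Fin 2 × Fin 2) (v : Fin 3 → ℝ) :
    pair (0, Pi.single i 1) 1 v = (posDir 0 v).1 i := by
  rw [← pair_single_add]
  simp [pair]

theorem coordDeriv_comp_reduction {F : E5 → ℝ} {z : PhaseSpace}
    (hF : DifferentiableAt ℝ F (reduction z)) :
    coordDeriv (F ∘ reduction) z =
      (fderiv ℝ F (reduction z)).comp (fderiv ℝ reductionCoords (coords z)) := by
  -- The inverse chart is meaningful only on the range of `coords`, which is open; agreement near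
  -- the point suffices for the derivative.
  have h : (F ∘ reduction) ∘ (isOpenEmbedding_coords.toOpenPartialHomeomorph coords).symm
      =ᶠ[𝓝 (coords z)] F ∘ reductionCoords := by
    filter_upwards [isOpenEmbedding_coords.isOpen_range.mem_nhds (mem_range_self z)] with y hy
    simp only [Function.comp_apply, reduction, coords_symm hy]
  rw [coordDeriv, h.fderiv_eq]
  exact fderiv_comp _ hF (differentiableAt_reductionCoords (mem_range_self z))

theorem sum_smul_single (w : Fin 2 × Fin 2 → ℝ) :
    ∑ i, w i • ((Pi.single i 1, 0) : Model) = (w, 0) := by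
  refine Prod.ext ?_ ?_
  · rw [Prod.fst_sum]
    funext j
    simp [Finset.sum_apply, Pi.single_apply]
  · rw [Prod.snd_sum]
    simp

theorem canonicalBracket_eq (f g : PhaseSpace → ℝ) (z : PhaseSpace) :
    canonicalBracket f g z = coordDeriv f z (fun i => dmom i g z, 0) -
      coordDeriv g z (fun i => dmom i f z, 0) := by
  rw [← sum_smul_single, ← sum_smul_single, map_sum, map_sum, canonicalBracket,
    Finset.sum_sub_distrib]
  simp only [map_smul, smul_eq_mul, dpos]
  congr 1
  exact Finset.sum_congr rfl fun i _ => mul_comm _ _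

/-- The momentum gradient of ξ ↦ ξ(v) is v itself. There is no term with ∂F/∂q because q does not
depend on the momenta. -/
theorem dmom_comp_reduction {F : E5 → ℝ} {z : PhaseSpace}
    (hF : DifferentiableAt ℝ F (reduction z)) :
    ((fun i => dmom i (F ∘ reduction) z, 0) : Model) =
      partialE5 0 F (reduction z) • posDir (dir₁ (pos (coords z) 0) (pos (coords z) 1))
          (dir₂ (pos (coords z) 0) (pos (coords z) 1)) +
        partialE5 1 F (reduction z) • posDir (normal (pos (coords z) 0) (pos (coords z) 1))
          (chDist (pos (coords z) 0) (pos (coords z) 1) •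
            normal (pos (coords z) 0) (pos (coords z) 1)) +
        partialE5 2 F (reduction z) • posDir 0 (shDist (pos (coords z) 0) (pos (coords z) 1) •
            normal (pos (coords z) 0) (pos (coords z) 1)) +
        partialE5 4 F (reduction z) • posDir 0 (dir₂ (pos (coords z) 0) (pos (coords z) 1)) := by
  refine Prod.ext (funext fun i => ?_) (by simp [posDir])
  simp only [dmom]
  rw [coordDeriv_comp_reduction hF, ContinuousLinearMap.comp_apply,
    fderiv_reductionCoords_mom (mem_range_self z), fderiv_apply_eq_sum_partialE5, ← pair_smul,
    ← pair_smul, pair_single_add, pair_single_add, pair_single, pair_single]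
  simp only [Prod.fst_add, Prod.smul_fst, Pi.add_apply, Pi.smul_apply, smul_eq_mul]
  simp only [Matrix.cons_val]
  ring

/-- The reduction map is a Poisson map. -/
theorem canonicalBracket_comp_reduction {F G : E5 → ℝ} {z : PhaseSpace}
    (hF : DifferentiableAt ℝ F (reduction z)) (hG : DifferentiableAt ℝ G (reduction z)) :
    canonicalBracket (F ∘ reduction) (G ∘ reduction) z = reducedBracket F G (reduction z) := by
  have hy := mem_range_self (f := coords) z
  rw [canonicalBracket_eq, dmom_comp_reduction hF, dmom_comp_reduction hG,
    coordDeriv_comp_reduction hF, coordDeriv_comp_reduction hG]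
  simp only [ContinuousLinearMap.comp_apply, map_add, map_smul, fderiv_reductionCoords_mx hy,
    fderiv_reductionCoords_my hy, fderiv_reductionCoords_mz hy, fderiv_reductionCoords_p hy]
  rw [reducedBracket_eq]
  simp only [fderiv_apply_eq_sum_partialE5 _ (reduction z), Matrix.cons_val]
  have h := isPair_pos hy
  -- Here too `dir₂` is split into `dir₁` and the first position, which occur in the derivative
  -- along the rotation. The pairings of each momentum with its own position cancel by antisymmetry.
  have e0 : (reduction z).1 0 = pair (coords z) 0 (dir₁ (pos (coords z) 0) (pos (coords z) 1)) +
      (chDist (pos (coords z) 0) (pos (coords z) 1) *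
        pair (coords z) 1 (dir₁ (pos (coords z) 0) (pos (coords z) 1)) +
      shDist (pos (coords z) 0) (pos (coords z) 1) * pair (coords z) 1 (pos (coords z) 0)) := by
    rw [← pair_smul, ← pair_smul, ← pair_add, ← h.dir₂_eq]
    rfl
  have e1 : (reduction z).1 1 =
      pair (coords z) 0 (normal (pos (coords z) 0) (pos (coords z) 1)) +
      chDist (pos (coords z) 0) (pos (coords z) 1) *
        pair (coords z) 1 (normal (pos (coords z) 0) (pos (coords z) 1)) := rfl
  have e2 : (reduction z).1 2 = shDist (pos (coords z) 0) (pos (coords z) 1) *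
        pair (coords z) 1 (normal (pos (coords z) 0) (pos (coords z) 1)) := rfl
  rw [e0, e1, e2]
  simp only [smul_eq_mul]
  ring

/-- The reduction map sends solutions of Hamilton's equations to solutions of the reduced
equations. -/
theorem hasDerivAt_reduction_comp {H : E5 → ℝ} {c : ℝ → PhaseSpace} {t : ℝ}
    (hH : DifferentiableAt ℝ H (reduction (c t))) (hc : HamiltonEqAt (H ∘ reduction) c t) :
    HasDerivAt (reduction ∘ c) (reducedVectorField H (reduction (c t))) t := by
  have hd := (differentiableAt_reductionCoords (mem_range_self (f := coords) (c t))).hasFDerivAt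
  have h1 := HasFDerivAt.comp_hasDerivAt t hd hc
  refine h1.congr_deriv ?_
  -- By Hamilton's equations L ∘ J changes at the rate of its canonical bracket with H ∘ J. Applying
  -- the Poisson property to linear L requires H to be merely differentiable at the point.
  have key : ∀ L : E5 →L[ℝ] ℝ, L (fderiv ℝ reductionCoords (coords (c t))
      (fun i => dmom i (H ∘ reduction) (c t), fun i => -dpos i (H ∘ reduction) (c t))) =
      reducedBracket L H (reduction (c t)) := by
    intro L
    rw [← canonicalBracket_comp_reduction L.differentiableAt hH, canonicalBracket]
    have e := coordDeriv_comp_reduction (F := L) (z := c t) L.differentiableAt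
    rw [L.fderiv] at e
    have e' : ∀ w, L (fderiv ℝ reductionCoords (coords (c t)) w) =
      coordDeriv (L ∘ reduction) (c t) w := fun w => by rw [e]; rfl
    have hw : ((fun i => dmom i (H ∘ reduction) (c t), fun i => -dpos i (H ∘ reduction) (c t)) :
        Model) = ∑ i, (dmom i (H ∘ reduction) (c t) • ((Pi.single i 1, 0) : Model) -
          dpos i (H ∘ reduction) (c t) • ((0, Pi.single i 1) : Model)) := by
      refine Prod.ext ?_ ?_
      · rw [Prod.fst_sum]
        funext j
        simp [Finset.sum_apply, Pi.single_apply]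
      · rw [Prod.snd_sum]
        funext j
        simp [Finset.sum_apply, Pi.single_apply]
    rw [e', hw, map_sum]
    refine Finset.sum_congr rfl fun i _ => ?_
    rw [map_sub, map_smul, map_smul]
    simp only [smul_eq_mul, dpos, dmom]
    ring
  refine Prod.ext (funext fun a => ?_) (Prod.ext ?_ ?_)
  · exact key (mCoordL a)
  · exact key qCoordL
  · exact key pCoordL

/-! ### The kinetic energy -/

theorem chDist_comm (a b : Fin 3 → ℝ) : chDist a b = chDist b a := by
  rw [chDist, mink_comm, chDist]

theorem shDist_comm (a b : Fin 3 → ℝ) : shDist a b = shDist b a := by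
  rw [shDist, chDist_comm, shDist]

theorem dir₂_eq_neg (a b : Fin 3 → ℝ) : dir₂ a b = -dir₁ b a := by
  rw [dir₂, dir₁, shDist_comm, chDist_comm]
  module

theorem normal_eq_neg (a b : Fin 3 → ℝ) : normal a b = -normal b a := by
  rw [normal, normal, shDist_comm, mcross_anticomm, smul_neg]

theorem IsPair.symm {a b : Fin 3 → ℝ} (h : IsPair a b) : IsPair b a :=
  ⟨h.right, h.left, by rw [chDist_comm]; exact h.one_lt⟩

/-- For tangent v one has v = a × (v × a) in the Minkowski product; writing the inner a as `normal`
× `dir₁` and expanding the double product yields the coefficients. -/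
theorem IsPair.tangent_left {a b : Fin 3 → ℝ} (h : IsPair a b) {v : Fin 3 → ℝ}
    (hv : mink a v = 0) :
    v = mink v (dir₁ a b) • dir₁ a b + mink v (normal a b) • normal a b := by
  have h1 : mcross a (mcross v a) = v := by
    rw [mcross_mcross_right, hv, h.left]
    simp
  have h2 := mcross_mcross_right v (normal a b) (dir₁ a b)
  rw [h.mcross_normal_dir₁] at h2
  rw [h2, mcross_sub_right, mcross_smul_right, mcross_smul_right, h.mcross_left_normal,
    h.mcross_left_dir₁, smul_neg, sub_neg_eq_add] at h1
  rw [add_comm]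
  exact h1.symm

/-- Exchanging the points reverses the sign of both frame vectors, and each enters the expansion
twice. -/
theorem IsPair.tangent_right {a b : Fin 3 → ℝ} (h : IsPair a b) {v : Fin 3 → ℝ}
    (hv : mink b v = 0) :
    v = mink v (dir₂ a b) • dir₂ a b + mink v (normal a b) • normal a b := by
  have h1 := h.symm.tangent_left hv
  rw [dir₂_eq_neg, normal_eq_neg, ← neg_one_smul ℝ (dir₁ b a), ← neg_one_smul ℝ (normal b a),
    mink_smul_right, mink_smul_right]
  conv_lhs => rw [h1]
  module

/-- The first vector of an orthonormal frame at the position of the body `a`. -/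
def frameVec (z : PhaseSpace) : Fin 2 → Fin 3 → ℝ :=
  ![dir₁ (z.R 0 : Fin 3 → ℝ) (z.R 1), dir₂ (z.R 0 : Fin 3 → ℝ) (z.R 1)]

/-- The second vector of an orthonormal frame at the positions of the bodies. -/
def frameNormal (z : PhaseSpace) : Fin 3 → ℝ := normal (z.R 0 : Fin 3 → ℝ) (z.R 1)

theorem frameVec_mem (z : PhaseSpace) (a : Fin 2) : frameVec z a ∈ tangentL2 (z.R a) := by
  fin_cases a
  · exact z.isPair.mink_left_dir₁
  · exact z.isPair.mink_right_dir₂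

theorem frameNormal_mem (z : PhaseSpace) (a : Fin 2) : frameNormal z ∈ tangentL2 (z.R a) := by
  fin_cases a
  · exact z.isPair.mink_left_normal
  · exact z.isPair.mink_right_normal

theorem mink_frameVec (z : PhaseSpace) (a : Fin 2) : mink (frameVec z a) (frameVec z a) = 1 := by
  fin_cases a
  · exact z.isPair.mink_dir₁_dir₁
  · exact z.isPair.mink_dir₂_dir₂

theorem mink_frameNormal (z : PhaseSpace) : mink (frameNormal z) (frameNormal z) = 1 :=
  z.isPair.mink_normal_normal

theorem mink_frameVec_frameNormal (z : PhaseSpace) (a : Fin 2) :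
    mink (frameVec z a) (frameNormal z) = 0 := by
  fin_cases a
  · exact z.isPair.mink_dir₁_normal
  · exact z.isPair.mink_dir₂_normal

theorem eq_frame {z : PhaseSpace} {a : Fin 2} {v : Fin 3 → ℝ} (hv : v ∈ tangentL2 (z.R a)) :
    v = mink v (frameVec z a) • frameVec z a + mink v (frameNormal z) • frameNormal z := by
  fin_cases a
  · exact z.isPair.tangent_left hv
  · exact z.isPair.tangent_right hv

/-- The kinetic energy in an orthonormal frame. -/
theorem kinetic_eq {μ : Fin 2 → ℝ} (hμ : ∀ a, 0 < μ a) (z : PhaseSpace) :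
    kinetic μ z = ∑ a, (pair (coords z) a (frameVec z a) ^ 2 +
      pair (coords z) a (frameNormal z) ^ 2) / (2 * μ a) := by
  -- The supremum is attained at the velocity dual to the momentum: frame components of the covector
  -- divided by the mass.
  refine IsGreatest.csSup_eq ⟨⟨fun a => (pair (coords z) a (frameVec z a) / μ a) •
    ⟨frameVec z a, frameVec_mem z a⟩ + (pair (coords z) a (frameNormal z) / μ a) •
    ⟨frameNormal z, frameNormal_mem z a⟩, ?_⟩, ?_⟩
  · simp only [kineticVelocity, Finset.mul_sum]
    rw [← Finset.sum_sub_distrib]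
    refine Finset.sum_congr rfl fun a _ => ?_
    have hne := (hμ a).ne'
    rw [covec_eq_pair]
    simp only [Submodule.coe_add, Submodule.coe_smul, pair_add, pair_smul, mink_add_left,
      mink_add_right, mink_smul_left, mink_smul_right, mink_frameVec, mink_frameNormal,
      mink_frameVec_frameNormal, mink_comm (frameNormal z) (frameVec z a)]
    field_simp
    ring
  · rintro _ ⟨v, rfl⟩
    simp only [kineticVelocity, Finset.mul_sum]
    rw [← Finset.sum_sub_distrib]
    refine Finset.sum_le_sum fun a _ => ?_
    have hp := hμ a
    rw [covec_eq_pair]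
    have hv := eq_frame (v a).2
    generalize mink (v a) (frameVec z a) = x at hv
    generalize mink (v a) (frameNormal z) = y at hv
    rw [hv]
    simp only [pair_add, pair_smul, mink_add_left,
      mink_add_right, mink_smul_left, mink_smul_right, mink_frameVec, mink_frameNormal,
      mink_frameVec_frameNormal, mink_comm (frameNormal z) (frameVec z a)]
    rw [le_div_iff₀ (by positivity)]
    -- Completing the square in each of the two frame components.
    nlinarith [sq_nonneg (pair (coords z) a (frameVec z a) - μ a * x),
      sq_nonneg (pair (coords z) a (frameNormal z) - μ a * y)]

/-- The frame momenta are m_x - p and m_y - coth(q) m_z for the first body, p and m_z / sinh(q) for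
the second; the sum of their squares over twice the masses is the quadratic form in (m, p). -/
theorem hamiltonian_eq {μ : Fin 2 → ℝ} (hμ : ∀ a, 0 < μ a) (U : ℝ → ℝ) (z : PhaseSpace) :
    hamiltonian μ U z = reducedHamiltonian (μ 0) (μ 1) U (reduction z) := by
  rw [hamiltonian, reducedHamiltonian, kinetic_eq hμ, ← qCoord_reduction]
  congr 1
  have h := z.isPair
  have hs := h.shDist_ne_zero
  have h0 := (hμ 0).ne'
  have h1 := (hμ 1).ne'
  simp only [A, dotProduct, Matrix.mulVec, Fin.sum_univ_three, Fin.sum_univ_two]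
  rw [reduction_eq]
  simp only [invariants, Real.sinh_arsinh, h.cosh_arsinh_shDist, frameVec, frameNormal]
  simp
  field_simp
  ring

theorem differentiableAt_reducedHamiltonian (μ₁ μ₂ : ℝ) {U : ℝ → ℝ}
    (hU : DifferentiableOn ℝ U (Ioi 0)) {x : E5} (hx : x ∈ reducedSet) :
    DifferentiableAt ℝ (reducedHamiltonian μ₁ μ₂ U) x := by
  have hs : Real.sinh x.2.1 ≠ 0 := (Real.sinh_pos_iff.2 hx).ne'
  have hU' : DifferentiableAt ℝ (fun x : E5 => U x.2.1) x :=
    (hU.differentiableAt (Ioi_mem_nhds hx)).comp x (by fun_prop)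
  have e : reducedHamiltonian μ₁ μ₂ U = fun x => 1 / (2 * μ₁) *
      (x.1 0 * x.1 0 + x.1 1 * (x.1 1 - Real.cosh x.2.1 / Real.sinh x.2.1 * x.1 2) +
        x.1 2 * (-(Real.cosh x.2.1 / Real.sinh x.2.1 * x.1 1) +
          (μ₁ / μ₂ + Real.cosh x.2.1 ^ 2) / Real.sinh x.2.1 ^ 2 * x.1 2) - 2 * x.1 0 * x.2.2 +
        (1 + μ₁ / μ₂) * x.2.2 ^ 2) + U x.2.1 := by
    funext x
    rw [reducedHamiltonian]
    simp only [A, dotProduct, Matrix.mulVec, Fin.sum_univ_three, Matrix.of_apply, Matrix.cons_val]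
    ring
  rw [e]
  refine DifferentiableAt.add ?_ hU'
  have hs2 : Real.sinh x.2.1 ^ 2 ≠ 0 := pow_ne_zero 2 hs
  fun_prop (disch := assumption)

/-! ### The reduced space -/

theorem continuous_reduction : Continuous reduction :=
  continuous_iff_continuousAt.2 fun z =>
    (contDiffAt_reductionCoords (mem_range_self z)).continuousAt.comp
      isOpenEmbedding_coords.continuous.continuousAt

theorem continuousOn_reductionSection : ContinuousOn reductionSection reducedSet := by
  rw [isOpenEmbedding_coords.isInducing.continuousOn_iff]
  refine ContinuousOn.congr (f := sectionCoords) (fun x hx => ?_) fun x hx =>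
    coords_reductionSection hx
  exact (contDiffAt_sectionCoords hx).continuousAt.continuousWithinAt

/-- The isomorphism of the reduced space with `ℝ³ × (0, ∞) × ℝ`. -/
def reductionHomeomorph : MulAction.orbitRel.Quotient SO21 PhaseSpace ≃ₜ reducedSet where
  toFun := Quotient.lift (fun z => (⟨reduction z, reduction_mem z⟩ : reducedSet)) (by
    rintro _ w ⟨g, rfl⟩
    exact Subtype.ext (reduction_smul g w))
  invFun x := Quotient.mk _ (reductionSection x)
  left_inv := by
    refine Quotient.ind fun z => ?_
    obtain ⟨g, hg⟩ := exists_smul_reductionSection z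
    exact (Quotient.sound ⟨g, hg⟩ : Quotient.mk (MulAction.orbitRel SO21 PhaseSpace) z = _).symm
  right_inv x := Subtype.ext (reduction_reductionSection x.2)
  continuous_toFun := (continuous_reduction.subtype_mk _).quotient_lift _
  continuous_invFun := continuous_quotient_mk'.comp
    (continuousOn_iff_continuous_domRestrict.1 continuousOn_reductionSection)

theorem contMDiff_iff_coords {F : Type*} [NormedAddCommGroup F] [NormedSpace ℝ F]
    {f : PhaseSpace → F} : ContMDiff 𝓘(ℝ, Model) 𝓘(ℝ, F) ∞ f ↔ ∀ z, ContDiffAt ℝ ∞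
      (f ∘ (isOpenEmbedding_coords.toOpenPartialHomeomorph coords).symm) (coords z) := by
  have e : f = (f ∘ (isOpenEmbedding_coords.toOpenPartialHomeomorph coords).symm) ∘ coords :=
    funext fun z => by simp only [Function.comp_apply, symm_coords]
  refine forall_congr' fun z => ?_
  rw [contMDiffAt_iff]
  simp only [mfld_simps, contDiffWithinAt_univ]
  refine ⟨fun h => h.2, fun h => ⟨?_, h⟩⟩
  rw [e]
  exact h.continuousAt.comp isOpenEmbedding_coords.continuous.continuousAt

theorem reduction_comp_symm_eventuallyEq {y : Model} (hy : y ∈ range coords) :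
    reduction ∘ (isOpenEmbedding_coords.toOpenPartialHomeomorph coords).symm =ᶠ[𝓝 y]
      reductionCoords := by
  filter_upwards [isOpenEmbedding_coords.isOpen_range.mem_nhds hy] with w hw
  simp only [Function.comp_apply, reduction, coords_symm hw]

theorem contMDiff_reduction : ContMDiff 𝓘(ℝ, Model) 𝓘(ℝ, E5) ∞ reduction :=
  contMDiff_iff_coords.2 fun z =>
    (contDiffAt_reductionCoords (mem_range_self z)).congr_of_eventuallyEq
      (reduction_comp_symm_eventuallyEq (mem_range_self z))

theorem mfderiv_reduction (z : PhaseSpace) :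
    mfderiv 𝓘(ℝ, Model) 𝓘(ℝ, E5) reduction z = fderiv ℝ reductionCoords (coords z) := by
  refine (contMDiff_reduction.mdifferentiable (by simp) z).mfderiv.trans ?_
  simp only [writtenInExtChartAt, mfld_simps, fderivWithin_univ]
  exact (reduction_comp_symm_eventuallyEq (mem_range_self z)).fderiv_eq

theorem exists_pair_eq (z : PhaseSpace) (x y : Fin 2 → ℝ) : ∃ ξ : Fin 2 × Fin 2 → ℝ,
    ∀ a, pair (0, ξ) a (frameVec z a) = x a ∧ pair (0, ξ) a (frameNormal z) = y a := by
  let w : PhaseSpace :=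
    { R := z.R
      ne := z.ne
      α := fun a =>
        { toFun := fun v => x a * mink v (frameVec z a) + y a * mink v (frameNormal z)
          map_add' := fun u v => by
            simp only [Submodule.coe_add, mink_add_left]
            ring
          map_smul' := fun c v => by
            simp only [Submodule.coe_smul, mink_smul_left, RingHom.id_apply, smul_eq_mul]
            ring } }
  refine ⟨(coords w).2, fun a => ⟨?_, ?_⟩⟩
  · refine (covec_eq_pair w a ⟨frameVec z a, frameVec_mem z a⟩).symm.trans ?_
    change x a * mink (frameVec z a) (frameVec z a) + y a * mink (frameVec z a) (frameNormal z) = _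
    rw [mink_frameVec, mink_frameVec_frameNormal]
    ring
  · refine (covec_eq_pair w a ⟨frameNormal z, frameNormal_mem z a⟩).symm.trans ?_
    change x a * mink (frameNormal z) (frameVec z a) + y a * mink (frameNormal z) (frameNormal z) =
      _
    rw [mink_frameNormal, mink_comm, mink_frameVec_frameNormal]
    ring

/-- Moving the second body along the geodesic produces any rate of change of q. The remaining
directions have no q-component and come from the momenta alone, since (m, p) is an invertible linear
function of the four frame momenta. -/
theorem surjective_fderiv_reductionCoords (z : PhaseSpace) :
    Function.Surjective (fderiv ℝ reductionCoords (coords z)) := by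
  intro v
  have hy := mem_range_self (f := coords) z
  have hs := z.isPair.shDist_ne_zero
  set D := fderiv ℝ reductionCoords (coords z) with hD
  set P := posDir 0 (dir₂ (pos (coords z) 0) (pos (coords z) 1)) with hP
  have hq : (D P).2.1 = 1 := by rw [hD, hP, fderiv_reductionCoords_p hy]
  set u : E5 := v - v.2.1 • D P with hu
  have hu0 : u.2.1 = 0 := by simp [hu, hq]
  obtain ⟨ξ, hξ⟩ := exists_pair_eq z ![u.1 0 - u.2.2, u.2.2] ![u.1 1 -
    chDist (z.R 0 : Fin 3 → ℝ) (z.R 1) * (u.1 2 / shDist (z.R 0 : Fin 3 → ℝ) (z.R 1)), u.1 2 / shDist (z.R 0 : Fin 3 → ℝ) (z.R 1)]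
  have hξ00 : pair (0, ξ) 0 (dir₁ (z.R 0 : Fin 3 → ℝ) (z.R 1)) = u.1 0 - u.2.2 := (hξ 0).1
  have hξ01 : pair (0, ξ) 0 (normal (z.R 0 : Fin 3 → ℝ) (z.R 1)) = _ := (hξ 0).2
  have hξ10 : pair (0, ξ) 1 (dir₂ (z.R 0 : Fin 3 → ℝ) (z.R 1)) = u.2.2 := (hξ 1).1
  have hξ11 : pair (0, ξ) 1 (normal (z.R 0 : Fin 3 → ℝ) (z.R 1)) = _ := (hξ 1).2
  have hDξ : D (0, ξ) = u := by
    rw [hD, fderiv_reductionCoords_mom hy, pos_coords, pos_coords, hξ00, hξ01, hξ10, hξ11]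
    refine Prod.ext (funext fun i => ?_) (Prod.ext hu0.symm rfl)
    fin_cases i
    · simp
    · simp
    · simp
      field_simp
  refine ⟨v.2.1 • P + (0, ξ), ?_⟩
  rw [map_add, map_smul, hDξ, hu]
  abel

/-- The converse direction uses the smooth section: f equals f ∘ J composed with it. -/
theorem contDiffOn_iff_comp_reduction (f : E5 → ℝ) : ContDiffOn ℝ ∞ f reducedSet ↔
    ContMDiff 𝓘(ℝ, Model) 𝓘(ℝ, ℝ) ∞ (f ∘ reduction) := by
  rw [contMDiff_iff_coords]
  constructor
  · intro hf z
    have h1 := hf.contDiffAt (isOpen_reducedSet.mem_nhds (reduction_mem z))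
    refine (ContDiffAt.comp (coords z) (g := f) h1
      (contDiffAt_reductionCoords (mem_range_self z))).congr_of_eventuallyEq ?_
    exact (reduction_comp_symm_eventuallyEq (mem_range_self z)).fun_comp f
  · intro hf x hx
    have h1 := hf (reductionSection x)
    rw [coords_reductionSection hx] at h1
    refine ((h1.comp x (contDiffAt_sectionCoords hx)).congr_of_eventuallyEq ?_).contDiffWithinAt
    filter_upwards [isOpen_reducedSet.mem_nhds hx] with w hw
    exact congrArg f (reduction_reductionSection hw).symm

end TwoBodyL2

end

open TwoBodyL2 in
/-- Reduction of the two-body problem on the Lobachevsky plane. -/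
theorem mainTheorem8 :
    -- the bracket on `ℝ³ × (0, ∞) × ℝ` is a Poisson bracket with the stated relations
    IsPoissonBracketOn reducedSet reducedBracket ∧
    (∀ x ∈ reducedSet,
      reducedBracket (mCoord 0) (mCoord 1) x = mCoord 2 x ∧
      reducedBracket (mCoord 1) (mCoord 2) x = -mCoord 0 x ∧
      reducedBracket (mCoord 2) (mCoord 0) x = -mCoord 1 x ∧
      reducedBracket qCoord pCoord x = 1 ∧
      ∀ a, reducedBracket (mCoord a) qCoord x = 0 ∧ reducedBracket (mCoord a) pCoord x = 0) ∧
    -- it is the product of the Lie-Poisson bracket of `so(2,1)*` and the canonical bracket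
    (∃ e : (Fin 3 → ℝ) ≃ₗ[ℝ] so21,
      (∀ w, (e w : Matrix (Fin 3) (Fin 3) ℝ) = tilde w) ∧
      ∀ (f g : E5 → ℝ), ∀ x ∈ reducedSet,
        reducedBracket f g x =
          -(x.1 ⬝ᵥ e.symm ⁅e (gradm f x), e (gradm g x)⁆)
            + (dq f x * dp g x - dp f x * dq g x)) ∧
    -- the isomorphism of Poisson manifolds and the reduced dynamics
    (∃ Φ : MulAction.orbitRel.Quotient SO21 PhaseSpace ≃ₜ reducedSet,
      let J : PhaseSpace → E5 := fun z => (Φ (Quotient.mk _ z) : E5)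
      (ContMDiff 𝓘(ℝ, Model) 𝓘(ℝ, E5) ∞ J ∧
        ∀ z, Function.Surjective (mfderiv 𝓘(ℝ, Model) 𝓘(ℝ, E5) J z)) ∧
      (∀ f : E5 → ℝ, ContDiffOn ℝ ∞ f reducedSet ↔
        ContMDiff 𝓘(ℝ, Model) 𝓘(ℝ, ℝ) ∞ (f ∘ J)) ∧
      (∀ f g : E5 → ℝ, ContDiffOn ℝ ∞ f reducedSet → ContDiffOn ℝ ∞ g reducedSet →
        ∀ z, canonicalBracket (f ∘ J) (g ∘ J) z = reducedBracket f g (J z)) ∧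
      (∀ z, qCoord (J z) = riemDist (z.R 0) (z.R 1)) ∧
      ∀ (μ : Fin 2 → ℝ) (U : ℝ → ℝ), (∀ a, 0 < μ a) → DifferentiableOn ℝ U (Set.Ioi 0) →
        (∀ z, hamiltonian μ U z = reducedHamiltonian (μ 0) (μ 1) U (J z)) ∧
        ∀ (c : ℝ → PhaseSpace) (t : ℝ), HamiltonEqAt (hamiltonian μ U) c t →
          HasDerivAt (J ∘ c)
            (reducedVectorField (reducedHamiltonian (μ 0) (μ 1) U) (J (c t))) t) ∧
    -- the Casimir function, and its uniqueness up to functional dependence where `m ≠ 0`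
    IsCasimirOn reducedSet reducedBracket casimir ∧
    (∀ F, IsCasimirOn reducedSet reducedBracket F → ∀ x ∈ reducedSet, x.1 ≠ 0 →
      ∃ l : ℝ, fderiv ℝ F x = l • fderiv ℝ casimir x) := by
  refine ⟨isPoissonBracketOn_reducedBracket, fun x _ => reducedBracket_coord x,
    ⟨tildeEquiv, fun _ => rfl, fun f g x _ => reducedBracket_eq_liePoisson f g x⟩,
    ⟨reductionHomeomorph, ⟨contMDiff_reduction, fun z => ?_⟩, contDiffOn_iff_comp_reduction,
      fun f g hf hg z => ?_, qCoord_reduction, fun μ U hμ hU =>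
        ⟨hamiltonian_eq hμ U, fun c t hc => ?_⟩⟩,
    isCasimirOn_casimir, fun F hF x hx hm => hF.exists_fderiv_eq_smul hx hm⟩
  · change Function.Surjective (mfderiv 𝓘(ℝ, Model) 𝓘(ℝ, E5) reduction z)
    rw [mfderiv_reduction]
    exact surjective_fderiv_reductionCoords z
  · exact canonicalBracket_comp_reduction
      (differentiableAt_of_contDiffOn_reducedSet hf (reduction_mem z))
      (differentiableAt_of_contDiffOn_reducedSet hg (reduction_mem z))
  · have e : hamiltonian μ U = reducedHamiltonian (μ 0) (μ 1) U ∘ reduction :=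
      funext (hamiltonian_eq hμ U)
    rw [e] at hc
    exact hasDerivAt_reduction_comp
      (differentiableAt_reducedHamiltonian _ _ hU (reduction_mem _)) hc
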